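/- **Setting.** Let $d\ge 1$. For $\delta>0$ let $\lambda_\delta$ be $\delta^d$ times the counting measure on $\delta\mathbb Z^d$; let $\lambda_0$ be Lebesgue measure on $\mathbb R^d$ and put $0\mathbb Z^d:=\mathbb R^d$. For a non-negative function $f$ on $\mathbb R^d$ put $S_\delta(f)=\int_{\delta\mathbb Z^d}f(t)\,\lambda_\delta(dt)\in[0,\infty]$. For a non-negative random field $W$ and $\delta,x\ge 0$, the Berman function is $$\mathcal B_W^\delta(x)=\lim_{T\to\infty}\frac1{T^d}\int_0^\infty \mathbb P\Big(\int_{[0,T]^d\cap\delta\mathbb Z^d}\mathbb I(W(t)>s)\,\lambda_\delta(dt)>x\Big)ds,$$ whenever this limit exists. Let $Z(t)$, $t\in\mathbb R^d$, be a non-negative random field with almost surely (generalised) càdlàg sample paths such that $\mathbb E Z(t)=1$ for all $t\in\mathbb R^d$, $\mathbb E\sup_{t\in[0,T]^d}Z(t)<\infty$ for all $T>0$, and $\mathbb P(\sup_{t\in\mathbb R^d}Z(t)>0)=1$. Suppose that the max-stable random field $$X(t)=\max_{i\ge1}\Gamma_i^{-1}Z^{(i)}(t),\quad t\in\mathbb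 R^d,$$ is stationary, where $\Gamma_i=\sum_{k=1}^i\mathcal V_k$ with independent unit exponential random variables $\mathcal V_k$, which are independent of the independent copies $Z^{(i)}$, $i\ge 1$, of $Z$. Let $\Theta$ be a random field with almost surely càdlàg sample paths and law $A\mapsto\mathbb E[Z(0)\,\mathbb I(Z/Z(0)\in A)]$. Write $S_0=S_0(Z)$. **Lemma.** Let $\delta,x\ge0$. (i) If $S_0<\infty$ almost surely, then, with $Q_\delta=\Theta/S_\delta(\Theta)$, the limit $\mathcal B_Z^\delta(x)$ exists and $$\mathcal B_Z^\delta(x)=\int_0^\infty\mathbb P\Big(\int_{\delta\mathbb Z^d}\mathbb I(Q_\delta(t)>s)\,\lambda_\delta(dt)>x\Big)ds<\infty .$$ (ii) If $\mathbb P(S_0<\infty)>0$, let $V$ be $Z$ conditioned on the event $\{S_0<\infty\}$ and normalised to have mean one, i.e. $V$ has the conditional law of $Z/\mathbb E[Z(0)\mid S_0<\infty]$ given $S_0<\infty$. Then the limits $\mathcal B_Z^\delta(x)$ and $\mathcal B_V^\delta(x)$ exist and $$\mathcal B_Z^\delta(x)=\mathbb P(S_0(\Theta)<\infty)\,\mathcal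 B_V^\delta(x)<\infty .$$ -/

import Mathlib

open MeasureTheory ProbabilityTheory Filter Topology Set
open scoped NNReal ENNReal

/-- Functions `ℝᵈ → [0, ∞)`, with the σ-field generated by the coordinate projections
(the product σ-field). On càdlàg functions it coincides with the σ-field generated by the
projections at the points of any countable dense set. -/
abbrev FieldPath (d : ℕ) : Type := (Fin d → ℝ) → ℝ≥0

/-- The quadrant at `t` with signs `ρ`: those `s` with `t i ≤ s i` where `ρ i` is true and
`s i < t i` where `ρ i` is false. -/
def quadrant {d : ℕ} (t : Fin d → ℝ) (ρ : Fin d → Bool) : Set (Fin d → ℝ) :=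
  {s | ∀ i, if ρ i = true then t i ≤ s i else s i < t i}

/-- (Generalised) càdlàg functions on `ℝᵈ`: at every point the limit from each of the `2 ^ d`
quadrants exists, and the function is continuous from the upper closed quadrant. -/
def IsCadlag {d : ℕ} (f : FieldPath d) : Prop :=
  ∀ t, (∀ ρ, ∃ l : ℝ≥0, Tendsto f (𝓝[quadrant t ρ] t) (𝓝 l)) ∧ ContinuousWithinAt f (Ici t) t

/-- The measure `λ_δ`: Lebesgue measure on `ℝᵈ` if `δ = 0`, and `δ ^ d` times the counting
measure on the lattice `δ ℤᵈ` if `δ > 0`. -/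
noncomputable def lam (d : ℕ) (δ : ℝ≥0) : Measure (Fin d → ℝ) :=
  if δ = 0 then volume
  else ((δ : ℝ≥0∞) ^ d) •
    Measure.sum (fun k : Fin d → ℤ => Measure.dirac (fun i => (δ : ℝ) * (k i : ℝ)))

/-- `S_δ(f) = ∫_{δ ℤᵈ} f(t) λ_δ(dt)`, with values in `[0, ∞]`. -/
noncomputable def totalMass {d : ℕ} (δ : ℝ≥0) (f : FieldPath d) : ℝ≥0∞ :=
  ∫⁻ t, (f t : ℝ≥0∞) ∂(lam d δ)

/-- The sojourn functional `∫_{K ∩ δ ℤᵈ} 𝟙(f(t) > s) λ_δ(dt)`. -/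
noncomputable def sojourn {d : ℕ} (δ : ℝ≥0) (K : Set (Fin d → ℝ)) (s : ℝ) (f : FieldPath d) : ℝ≥0∞ :=
  lam d δ {t | t ∈ K ∧ s < (f t : ℝ)}

/-- `∫_0^∞ P (∫_{K ∩ δ ℤᵈ} 𝟙(W(t) > s) λ_δ(dt) > x) ds`. -/
noncomputable def bermanOn {d : ℕ} {Ω : Type*} [MeasurableSpace Ω] (P : Measure Ω)
    (W : Ω → FieldPath d) (δ : ℝ≥0) (K : Set (Fin d → ℝ)) (x : ℝ≥0) : ℝ≥0∞ :=
  ∫⁻ s in Ioi (0 : ℝ), P {ω | (x : ℝ≥0∞) < sojourn δ K s (W ω)}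

/-- The normalised quantity `T ^ (-d) * 𝓑_W^δ([0, T]ᵈ ∩ δ ℤᵈ, x)`. -/
noncomputable def bermanRatio {d : ℕ} {Ω : Type*} [MeasurableSpace Ω] (P : Measure Ω)
    (W : Ω → FieldPath d) (δ x : ℝ≥0) (T : ℝ) : ℝ≥0∞ :=
  bermanOn P W δ (Icc 0 (fun _ => T)) x / ENNReal.ofReal (T ^ d)

/-- The Berman function `𝓑_W^δ(x)`, the limit of the normalised quantity as `T → ∞`
(meaningful when that limit exists). -/
noncomputable def berman {d : ℕ} {Ω : Type*} [MeasurableSpace Ω] (P : Measure Ω)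
    (W : Ω → FieldPath d) (δ x : ℝ≥0) : ℝ≥0∞ :=
  limUnder atTop (bermanRatio P W δ x)

/-- The assumptions on the field `Z` itself: it is a random field with almost surely càdlàg
paths, mean one, locally integrable suprema, and it almost surely does not vanish identically. -/
structure IsSpectralField {d : ℕ} {Ω : Type*} [MeasurableSpace Ω] (P : Measure Ω)
    (Z : Ω → FieldPath d) : Prop where
  measurable : Measurable Z
  cadlag : ∀ᵐ ω ∂P, IsCadlag (Z ω)
  mean_one : ∀ t, ∫⁻ ω, (Z ω t : ℝ≥0∞) ∂P = 1
  sup_integrable : ∀ T : ℝ, 0 < T →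
    ∫⁻ ω, (⨆ t ∈ Icc (0 : Fin d → ℝ) (fun _ => T), (Z ω t : ℝ≥0∞)) ∂P < ∞
  nonzero : ∀ᵐ ω ∂P, ∃ t, 0 < Z ω t

/-- The random input of the de Haan representation with spectral field `Z`: independent unit
exponential variables `E k`, and, independent of them, independent copies `Zc i` of `Z`. -/
structure IsDeHaanInput {d : ℕ} {Ω Ω₁ : Type*} [MeasurableSpace Ω] [MeasurableSpace Ω₁]
    (P : Measure Ω) (Z : Ω → FieldPath d) (P₁ : Measure Ω₁)
    (E : ℕ → Ω₁ → ℝ) (Zc : ℕ → Ω₁ → FieldPath d) : Prop where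
  measurable_exp : ∀ k, Measurable (E k)
  law_exp : ∀ k, P₁.map (E k) = expMeasure 1
  indep_exp : iIndepFun E P₁
  measurable_copy : ∀ i, Measurable (Zc i)
  law_copy : ∀ i, P₁.map (Zc i) = P.map Z
  indep_copy : iIndepFun Zc P₁
  indep : IndepFun (fun ω k => E k ω) (fun ω i => Zc i ω) P₁

/-- The max-stable field `X(t) = max_i Γ_i⁻¹ Z⁽ⁱ⁾(t)`, where `Γ_i` is the sum of the exponential
variables up to (and including) index `i`; indices start at `0`. -/
noncomputable def deHaanField {d : ℕ} {Ω₁ : Type*} (E : ℕ → Ω₁ → ℝ) (Zc : ℕ → Ω₁ → FieldPath d) :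
    Ω₁ → (Fin d → ℝ) → ℝ≥0∞ :=
  fun ω t => ⨆ i : ℕ, (Zc i ω t : ℝ≥0∞) / ENNReal.ofReal (∑ k ∈ Finset.range (i + 1), E k ω)

/-- Stationarity: the laws of `X(· + h)` and `X` (equivalently, their finite-dimensional
distributions) agree for every shift `h`. -/
def IsStationaryField {d : ℕ} {Ω₁ : Type*} [MeasurableSpace Ω₁] (P₁ : Measure Ω₁)
    (X : Ω₁ → (Fin d → ℝ) → ℝ≥0∞) : Prop :=
  ∀ h : Fin d → ℝ, P₁.map (fun ω t => X ω (t + h)) = P₁.map X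

/-- `Θ` is a random field with almost surely càdlàg paths whose law is
`A ↦ E[Z(0) 𝟙(Z / Z(0) ∈ A)]`. -/
structure IsTiltedField {d : ℕ} {Ω Ω₂ : Type*} [MeasurableSpace Ω] [MeasurableSpace Ω₂]
    (P : Measure Ω) (Z : Ω → FieldPath d) (P₂ : Measure Ω₂) (Θ : Ω₂ → FieldPath d) : Prop where
  measurable : Measurable Θ
  cadlag : ∀ᵐ ω ∂P₂, IsCadlag (Θ ω)
  law : ∀ A : Set (FieldPath d), MeasurableSet A →
    P₂ {ω | Θ ω ∈ A} = ∫⁻ ω in {ω | (fun t => Z ω t / Z ω 0) ∈ A}, (Z ω 0 : ℝ≥0∞) ∂P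

/-- The field `Q_δ = Θ / S_δ(Θ)`. -/
noncomputable def normalizedField {d : ℕ} {Ω₂ : Type*} (δ : ℝ≥0) (Θ : Ω₂ → FieldPath d) :
    Ω₂ → FieldPath d :=
  fun ω t => Θ ω t / (totalMass δ (Θ ω)).toNNReal

/-- The law `P(· | S_0(Z) < ∞)`. -/
noncomputable def finiteMassCond {d : ℕ} {Ω : Type*} [MeasurableSpace Ω] (P : Measure Ω)
    (Z : Ω → FieldPath d) : Measure Ω :=
  ProbabilityTheory.cond P {ω | totalMass 0 (Z ω) < ∞}

/-- The field `V`, to be considered under the conditional law `P(· | S_0(Z) < ∞)`: the field `Z`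
rescaled by the constant `E[Z(0) | S_0(Z) < ∞]`, so that it has mean one under that law. -/
noncomputable def conditionedField {d : ℕ} {Ω : Type*} [MeasurableSpace Ω] (P : Measure Ω)
    (Z : Ω → FieldPath d) : Ω → FieldPath d :=
  fun ω t => Z ω t / (∫⁻ ω', (Z ω' 0 : ℝ≥0∞) ∂(finiteMassCond P Z)).toNNReal

/-! ### The maximum of a de Haan series -/

/-! Everything rests on one invariance. The field `Z` need not be stationary, but stationarity of
the max-stable field forces `E G(Z(· + h)) = E G(Z)` for every measurable `G ≥ 0` that is
homogeneous of degree one (`IsMaxInvariant.lintegral_shift`). The tail of a weighted maximum of `X`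
determines the mean of the same weighted maximum of `Z` (`lintegral_weightedMax_eq_liminf`).
Differentiating these means in one weight recovers the law of `Z / Z(t)` tilted by `Z(t)`
(`IsMaxInvariant.tiltedLaw_eq`), and expectations of homogeneous functionals are sums of integrals
against such tilted laws.

By Tonelli, the Berman integral over `K` is the mean of the homogeneous functional `excess δ K x`.
Cut space into cubes of side `δ` (side `1` if `δ = 0`), and split the mean over a box of cubes
according to the lexicographically first cube where the supremum of the path is largest. By
invariance, the term of cube `j` is the term of cube `0` for the box seen from `j`. Deep inside the
box this is nearly the mean on the event that cube `0` is the first maximum over all of space; every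
term is at most the mean supremum over one cube, so the boundary disappears in the average
(`tendsto_setLIntegral_excess_box`). Hence the limit exists and is finite without any assumption on
`S_0`.

The limit is identified by the mass transport principle (`mass_transport`). A path with a first
maximal cube almost surely has summable cube suprema, hence finite `S_0`; so paths of infinite mass
contribute nothing. This gives (ii): restricting to `S_0 < ∞` does not change the limit, and only
the normalising constants remain, with `E[Z(0); S_0 < ∞] = P(S_0(Θ) < ∞)`. Conversely, finite `S_0`
almost surely makes the cube suprema summable, so that a first maximal cube exists and `S_δ` is
finite. Under the assumption of (i), a transport of mass then replaces the event that cube `0` comes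
first by the weight `Z(0) / S_δ(Z)`, which is the formula with `Q_δ`
(`setLIntegral_excess_firstMax_eq`). -/

lemma expMeasure_Iic (u : ℝ) (hu : 0 ≤ u) :
    expMeasure 1 (Iic u) = ENNReal.ofReal (1 - Real.exp (-u)) := by
  rw [expMeasure, gammaMeasure, withDensity_apply _ measurableSet_Iic]
  have := lintegral_exponentialPDF_eq_antiDeriv (r := 1) one_pos u
  rw [if_pos hu, one_mul] at this
  exact this

/-- The half-open interval provides both the sign of the arrival time and the strict inequality that
are needed to divide by it in `ℝ≥0∞`. -/
lemma expMeasure_Ico (u : ℝ) (hu : 0 ≤ u) :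
    ENNReal.ofReal (1 - Real.exp (-u)) ≤ expMeasure 1 (Ico 0 u) := by
  have : NullSingletonClass (expMeasure 1) := by
    rw [expMeasure, gammaMeasure]
    infer_instance
  have h0 : expMeasure 1 (Iio 0) = 0 := by
    rw [expMeasure, gammaMeasure, withDensity_apply _ measurableSet_Iio]
    exact lintegral_exponentialPDF_of_nonpos le_rfl
  have h1 : expMeasure 1 (Iic u) = expMeasure 1 (Iio u) := measure_congr Iio_ae_eq_Iic.symm
  rw [← expMeasure_Iic u hu, h1, ← Iio_union_Ico_eq_Iio hu]
  exact (measure_union_le _ _).trans (by simp [h0])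

/-- The renewal inequality for exponential waiting times, integrated against the first one. -/
lemma expMeasure_renewal (u : ℝ) :
    expMeasure 1 (Iic u) + ∫⁻ v, ENNReal.ofReal (u - v) ∂(expMeasure 1) ≤ ENNReal.ofReal u := by
  rw [← lintegral_indicator_one measurableSet_Iic, ← lintegral_add_right _ (by fun_prop), expMeasure,
    gammaMeasure, lintegral_withDensity_eq_lintegral_mul _ (f := gammaPDF 1 1)
      (measurable_gammaPDFReal 1 1).ennreal_ofReal
      (by exact (measurable_one.indicator measurableSet_Iic).add (by fun_prop))]
  have hle : ∀ v, (gammaPDF 1 1 * fun a => (Iic u).indicator (1 : ℝ → ℝ≥0∞) a + ENNReal.ofReal (u - a)) v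
      ≤ (Icc 0 u).indicator (fun v => ENNReal.ofReal (Real.exp (-v) * (1 + (u - v)))) v := by
    intro v
    rw [Pi.mul_apply]
    change exponentialPDF 1 v * _ ≤ _
    rcases lt_or_ge v 0 with hv | hv
    · simp [exponentialPDF_of_neg hv]
    rcases lt_or_ge u v with huv | huv
    · simp [huv, huv.le]
    rw [indicator_of_mem (show v ∈ Icc 0 u from ⟨hv, huv⟩), indicator_of_mem (show v ∈ Iic u from huv),
      exponentialPDF_of_nonneg hv, Pi.one_apply, ← ENNReal.ofReal_one,
      ← ENNReal.ofReal_add zero_le_one (by linarith), ← ENNReal.ofReal_mul (by positivity)]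
    simp
  refine (lintegral_mono hle).trans ?_
  rw [lintegral_indicator measurableSet_Icc]
  rcases lt_or_ge u 0 with hu | hu
  · simp [hu]
  -- This antiderivative vanishes at `u` and equals `-u` at `0`, so for `u ≥ 0` the integral of the
  -- dominating function is exactly `u`.
  have hder : ∀ v ∈ uIcc 0 u, HasDerivAt (fun v => -(Real.exp (-v) * (u - v)))
      (Real.exp (-v) * (1 + (u - v))) v := by
    intro v _
    have h1 : HasDerivAt (fun v : ℝ => Real.exp (-v)) (-Real.exp (-v)) v := by
      simpa using (hasDerivAt_neg v).exp
    have h2 : HasDerivAt (fun v : ℝ => u - v) (-1) v := by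
      simpa using (hasDerivAt_id v).const_sub u
    exact (h1.mul h2).neg.congr_deriv (by ring)
  have hcont : Continuous fun v : ℝ => Real.exp (-v) * (1 + (u - v)) := by fun_prop
  rw [← ofReal_integral_eq_lintegral_ofReal (hcont.integrableOn_Icc)
    (ae_restrict_of_forall_mem measurableSet_Icc fun v hv =>
      mul_nonneg (Real.exp_pos _).le (by linarith [hv.2])),
    integral_Icc_eq_integral_Ioc, ← intervalIntegral.integral_of_le hu,
    intervalIntegral.integral_eq_sub_of_hasDerivAt hder (hcont.intervalIntegrable _ _)]
  simp

/-- The arrival times form a unit-rate Poisson process, whose mean number of points up to `u` is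
`u⁺`. The induction runs over all `u` at once and closes by the renewal inequality. -/
lemma sum_measure_arrival_le {Ω₁ : Type*} [MeasurableSpace Ω₁] {P₁ : Measure Ω₁}
    [IsProbabilityMeasure P₁] {E : ℕ → Ω₁ → ℝ} (hm : ∀ k, Measurable (E k))
    (hl : ∀ k, P₁.map (E k) = expMeasure 1) (hi : iIndepFun E P₁) (N : ℕ) (u : ℝ) :
    ∑ n ∈ Finset.range N, P₁ {ω | ∑ k ∈ Finset.range (n + 1), E k ω ≤ u} ≤ ENNReal.ofReal u := by
  have : IsProbabilityMeasure (expMeasure 1) := isProbabilityMeasure_expMeasure one_pos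
  have hS : ∀ n, Measurable fun ω => ∑ k ∈ Finset.range (n + 1), E k ω := fun n =>
    Finset.measurable_sum _ fun k _ => hm k
  induction N generalizing u with
  | zero => simp
  | succ N ih =>
    rw [Finset.sum_range_succ']
    have h0 : P₁ {ω | ∑ k ∈ Finset.range (0 + 1), E k ω ≤ u} = expMeasure 1 (Iic u) := by
      rw [← hl 0, Measure.map_apply (hm 0) measurableSet_Iic]
      simp [preimage]
    -- Conditioning on the last waiting time, instead of the first, leaves a partial sum of the same
    -- sequence, so the induction hypothesis applies without reindexing.
    have hstep : ∀ n, P₁ {ω | ∑ k ∈ Finset.range (n + 1 + 1), E k ω ≤ u}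
        = ∫⁻ v, P₁ {ω | ∑ k ∈ Finset.range (n + 1), E k ω ≤ u - v} ∂(expMeasure 1) := by
      intro n
      have hind : IndepFun (E (n + 1)) (fun ω => ∑ k ∈ Finset.range (n + 1), E k ω) P₁ := by
        have := hi.indepFun_finsetSum_of_notMem hm (s := Finset.range (n + 1)) (i := n + 1) (by simp)
        convert this.symm using 1
        ext ω; simp
      have hmap := (indepFun_iff_map_prod_eq_prod_map_map (hm (n + 1)).aemeasurable
        (hS n).aemeasurable).1 hind
      have hset : MeasurableSet {p : ℝ × ℝ | p.1 + p.2 ≤ u} :=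
        measurableSet_le (by fun_prop) measurable_const
      have : {ω | ∑ k ∈ Finset.range (n + 1 + 1), E k ω ≤ u}
          = (fun ω => (E (n + 1) ω, ∑ k ∈ Finset.range (n + 1), E k ω)) ⁻¹'
            {p : ℝ × ℝ | p.1 + p.2 ≤ u} := by
        ext ω; simp only [mem_ofPred_eq, mem_preimage]; rw [Finset.sum_range_succ, add_comm]
      rw [this, ← Measure.map_apply ((hm _).prodMk (hS n)) hset, hmap, Measure.prod_apply hset, hl]
      refine lintegral_congr fun v => ?_
      have h2 : Prod.mk v ⁻¹' {p : ℝ × ℝ | p.1 + p.2 ≤ u} = Iic (u - v) := by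
        ext w; simp [le_sub_iff_add_le']
      rw [h2, Measure.map_apply (hS n) measurableSet_Iic]
      rfl
    have hmeas : ∀ n, Measurable fun v : ℝ =>
        P₁ {ω | ∑ k ∈ Finset.range (n + 1), E k ω ≤ u - v} := by
      intro n
      refine Antitone.measurable fun a b hab => measure_mono fun ω hω => ?_
      exact le_trans (show _ ≤ u - b from hω) (by linarith)
    rw [h0, Finset.sum_congr rfl fun n _ => hstep n, ← lintegral_finsetSum _ fun n _ => hmeas n,
      add_comm]
    exact (add_le_add_right (lintegral_mono fun v => ih (u - v)) _).trans (expMeasure_renewal u)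

/-- The weighted maximum of the values of a path at finitely many points. -/
noncomputable def weightedMax {d : ℕ} (s : Finset ((Fin d → ℝ) × ℝ≥0)) (f : FieldPath d) : ℝ≥0 :=
  s.sup fun p => p.2 * f p.1

/-- The weighted maximum of the values of an extended path at finitely many points. -/
noncomputable def weightedMaxENN {d : ℕ} (s : Finset ((Fin d → ℝ) × ℝ≥0))
    (f : (Fin d → ℝ) → ℝ≥0∞) : ℝ≥0∞ :=
  s.sup fun p => p.2 * f p.1

lemma coe_weightedMax {d : ℕ} (s : Finset ((Fin d → ℝ) × ℝ≥0)) (f : FieldPath d) :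
    (weightedMax s f : ℝ≥0∞) = s.sup fun p => (p.2 : ℝ≥0∞) * f p.1 := by
  rw [weightedMax, Finset.apply_sup_eq_sup_comp (fun r : ℝ≥0 => (r : ℝ≥0∞))
    (fun a b => ENNReal.coe_max a b) rfl]
  simp [Function.comp_def]

lemma measurable_weightedMaxENN {d : ℕ} (s : Finset ((Fin d → ℝ) × ℝ≥0)) :
    Measurable (weightedMaxENN s) := by
  unfold weightedMaxENN
  simp only [Finset.sup_eq_iSup]
  exact Measurable.biSup _ s.countable_toSet fun p _ => (measurable_pi_apply p.1).const_mul _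

lemma measurable_weightedMax {d : ℕ} (s : Finset ((Fin d → ℝ) × ℝ≥0)) :
    Measurable (weightedMax s) := by
  suffices h : Measurable fun f => (weightedMax s f : ℝ≥0∞) by simpa using h.ennreal_toNNReal
  simp only [coe_weightedMax, Finset.sup_eq_iSup]
  exact Measurable.biSup _ s.countable_toSet fun p _ =>
    (measurable_pi_apply p.1).coe_nnreal_ennreal.const_mul _

/-- Suprema commute, which reduces weighted maxima of the field to a scalar de Haan series. -/
lemma weightedMaxENN_deHaanField {d : ℕ} {Ω₁ : Type*} (s : Finset ((Fin d → ℝ) × ℝ≥0))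
    (E : ℕ → Ω₁ → ℝ) (Zc : ℕ → Ω₁ → FieldPath d) (ω : Ω₁) :
    weightedMaxENN s (deHaanField E Zc ω) = ⨆ i : ℕ, (weightedMax s (Zc i ω) : ℝ≥0∞) /
      ENNReal.ofReal (∑ k ∈ Finset.range (i + 1), E k ω) := by
  simp only [weightedMaxENN, deHaanField, coe_weightedMax, Finset.sup_eq_iSup, ENNReal.mul_iSup,
    div_eq_mul_inv, ENNReal.iSup_mul, ← mul_assoc]
  rw [iSup_congr fun p => iSup_comm, iSup_comm]

/-- The derivative of `z ↦ 1 - exp (-u z)` at `0` is `u`; take `z = 1 / (n + 1)`. -/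
lemma le_liminf_mul_one_sub_exp (u : ℝ≥0) :
    (u : ℝ≥0∞) ≤ liminf (fun n : ℕ => ((n + 1 : ℕ) : ℝ≥0∞) *
      ENNReal.ofReal (1 - Real.exp (-((u : ℝ) / ((n + 1 : ℕ) : ℝ))))) atTop := by
  have h1 : Tendsto (fun y : ℝ => y * (1 - Real.exp (-((u : ℝ) / y)))) atTop (𝓝 u) := by
    have hd : HasDerivAt (fun z : ℝ => 1 - Real.exp (-((u : ℝ) * z))) u 0 := by
      have h := (((hasDerivAt_id (0 : ℝ)).const_mul (u : ℝ)).neg.exp).const_sub 1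
      exact h.congr_deriv (by simp)
    have h2 := hd.tendsto_slope_zero_right
    have h3 := h2.comp tendsto_inv_atTop_nhdsGT_zero
    refine h3.congr fun y => ?_
    simp [div_eq_mul_inv]
  have h2 := ENNReal.tendsto_ofReal
    (h1.comp ((tendsto_natCast_atTop_atTop (R := ℝ)).comp (tendsto_add_atTop_nat 1)))
  rw [ENNReal.ofReal_coe_nnreal] at h2
  rw [← h2.liminf_eq]
  refine le_of_eq (congrArg (fun g => liminf g atTop) (funext fun n => ?_))
  simp only [Function.comp_apply]
  rw [ENNReal.ofReal_mul (by positivity), ENNReal.ofReal_natCast]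

/-- The mean of a weighted maximum of the spectral field is determined by the tail of the
corresponding weighted maximum of the max-stable field. -/
lemma lintegral_weightedMax_eq_liminf {d : ℕ} {Ω Ω₁ : Type*} [MeasurableSpace Ω]
    [MeasurableSpace Ω₁] {P : Measure Ω} [IsProbabilityMeasure P] {P₁ : Measure Ω₁}
    [IsProbabilityMeasure P₁] {Z : Ω → FieldPath d} (hZ : Measurable Z)
    {E : ℕ → Ω₁ → ℝ} {Zc : ℕ → Ω₁ → FieldPath d} (hX : IsDeHaanInput P Z P₁ E Zc)
    (s : Finset ((Fin d → ℝ) × ℝ≥0)) :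
    ∫⁻ ω, (weightedMax s (Z ω) : ℝ≥0∞) ∂P = liminf (fun n : ℕ => ((n + 1 : ℕ) : ℝ≥0∞) *
      P₁ {ω | ((n + 1 : ℕ) : ℝ≥0∞) < weightedMaxENN s (deHaanField E Zc ω)}) atTop := by
  have hS : ∀ n, Measurable fun ω => ∑ k ∈ Finset.range (n + 1), E k ω := fun n =>
    Finset.measurable_sum _ fun k _ => hX.measurable_exp k
  have hint : ∀ (i : ℕ) (A : Set (ℝ × FieldPath d)), MeasurableSet A →
      P₁ {ω | (∑ k ∈ Finset.range (i + 1), E k ω, Zc i ω) ∈ A}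
        = ∫⁻ ω, P₁ {ω' | (∑ k ∈ Finset.range (i + 1), E k ω', Z ω) ∈ A} ∂P := by
    intro i A hA
    have hind : IndepFun (fun ω => ∑ k ∈ Finset.range (i + 1), E k ω) (Zc i) P₁ :=
      hX.indep.comp (φ := fun e : ℕ → ℝ => ∑ k ∈ Finset.range (i + 1), e k) (ψ := fun z : ℕ → FieldPath d => z i)
        (by fun_prop) (measurable_pi_apply i)
    have hmap := (indepFun_iff_map_prod_eq_prod_map_map (hS i).aemeasurable
      (hX.measurable_copy i).aemeasurable).1 hind
    have : IsProbabilityMeasure (P.map Z) := Measure.isProbabilityMeasure_map hZ.aemeasurable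
    have h1 : {ω | (∑ k ∈ Finset.range (i + 1), E k ω, Zc i ω) ∈ A}
      = (fun ω => (∑ k ∈ Finset.range (i + 1), E k ω, Zc i ω)) ⁻¹' A := rfl
    rw [h1, ← Measure.map_apply ((hS i).prodMk (hX.measurable_copy i)) hA, hmap, hX.law_copy,
      Measure.prod_apply_symm hA, lintegral_map (measurable_measure_prodMk_right hA) hZ]
    refine lintegral_congr fun ω => ?_
    rw [Measure.map_apply (hS i) (measurable_prodMk_right hA)]
    rfl
  -- The lower bound uses strict inequality and a nonnegative arrival time, the upper bound a weak
  -- inequality and no sign. Thus `hlow` and `hup` hold for every real arrival time despite the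
  -- truncation in `ENNReal.ofReal`.
  have hAm : ∀ y : ℝ≥0, MeasurableSet
      {p : ℝ × FieldPath d | 0 ≤ p.1 ∧ p.1 * (y : ℝ) < weightedMax s p.2} :=
    fun y => (measurableSet_le measurable_const measurable_fst).inter (measurableSet_lt (by fun_prop)
      ((measurable_weightedMax s).comp measurable_snd).coe_nnreal_real)
  have hAm' : ∀ y : ℝ≥0, MeasurableSet {p : ℝ × FieldPath d | p.1 * (y : ℝ) ≤ weightedMax s p.2} :=
    fun y => measurableSet_le (by fun_prop)
      ((measurable_weightedMax s).comp measurable_snd).coe_nnreal_real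
  have hlow : ∀ (r : ℝ) (y w : ℝ≥0), 0 ≤ r → r * y < w → (y : ℝ≥0∞) < w / ENNReal.ofReal r := by
    intro r y w hr h
    lift r to ℝ≥0 using hr
    rw [ENNReal.ofReal_coe_nnreal]
    have h' : y * r < w := by rw [mul_comm]; exact_mod_cast h
    rw [ENNReal.lt_div_iff_mul_lt (Or.inr (by simp)) (Or.inl (by simp))]
    exact_mod_cast h'
  have hup : ∀ (r : ℝ) (y w : ℝ≥0), (y : ℝ≥0∞) < w / ENNReal.ofReal r → r * y ≤ w := by
    intro r y w h
    have h1 := ENNReal.mul_lt_of_lt_div h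
    rcases le_or_gt r 0 with hr | hr
    · exact (mul_nonpos_of_nonpos_of_nonneg hr y.2).trans w.2
    · lift r to ℝ≥0 using hr.le
      rw [ENNReal.ofReal_coe_nnreal] at h1
      rw [mul_comm]
      exact_mod_cast h1.le
  apply le_antisymm
  -- Lower bound: keep only the first term of the series and apply Fatou.
  · refine (lintegral_mono fun ω => le_liminf_mul_one_sub_exp (weightedMax s (Z ω))).trans ?_
    refine (lintegral_liminf_le fun n => ?_).trans ?_
    · have := (measurable_weightedMax s).comp hZ
      exact (ENNReal.measurable_ofReal.comp
        (by have := this.coe_nnreal_real; simp only [Function.comp_def] at this; fun_prop)).const_mul _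
    refine liminf_le_liminf (Eventually.of_forall fun n => ?_)
    rw [lintegral_const_mul' _ _ (by simp)]
    gcongr
    calc _ ≤ ∫⁻ ω, P₁ {ω' | (∑ k ∈ Finset.range (0 + 1), E k ω', Z ω) ∈
          {p : ℝ × FieldPath d | 0 ≤ p.1 ∧ p.1 * ((n + 1 : ℕ) : ℝ≥0) < weightedMax s p.2}} ∂P := by
          refine lintegral_mono fun ω => ?_
          refine (expMeasure_Ico _ (by positivity)).trans ?_
          rw [← hX.law_exp 0, Measure.map_apply (hX.measurable_exp 0) measurableSet_Ico]
          refine measure_mono fun ω' hω' => ?_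
          have h1 : E 0 ω' ∈ Ico (0 : ℝ) _ := hω'
          rw [mem_Ico, lt_div_iff₀ (by positivity)] at h1
          simpa using h1
      _ = _ := (hint 0 _ (hAm _)).symm
      _ ≤ _ := by
          refine measure_mono fun ω hω => ?_
          simp only [mem_ofPred_eq] at hω ⊢
          have h2 := hlow _ _ _ hω.1 hω.2
          rw [weightedMaxENN_deHaanField]
          exact lt_of_lt_of_le (by exact_mod_cast h2) (le_iSup (fun i : ℕ =>
            (weightedMax s (Zc i ω) : ℝ≥0∞) / ENNReal.ofReal (∑ k ∈ Finset.range (i + 1), E k ω)) 0)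
  · refine liminf_le_of_le (by isBoundedDefault) fun b hb => ?_
    -- Upper bound: the union bound over all terms and the renewal bound hold at each level, so a
    -- single `n` suffices.
    obtain ⟨n, hn⟩ := hb.exists
    refine hn.trans ?_
    have hy : (((n + 1 : ℕ) : ℝ≥0) : ℝ≥0∞) ≠ 0 := by simp
    calc _ ≤ ((n + 1 : ℕ) : ℝ≥0∞) * ∑' i, P₁ {ω | (∑ k ∈ Finset.range (i + 1), E k ω, Zc i ω) ∈
          {p : ℝ × FieldPath d | p.1 * ((n + 1 : ℕ) : ℝ≥0) ≤ weightedMax s p.2}} := by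
          gcongr
          refine (measure_mono fun ω hω => ?_).trans (measure_iUnion_le _)
          rw [mem_ofPred_eq, weightedMaxENN_deHaanField, lt_iSup_iff] at hω
          obtain ⟨i, hi⟩ := hω
          exact mem_iUnion.2 ⟨i, hup _ _ _ (by exact_mod_cast hi)⟩
      _ = ((n + 1 : ℕ) : ℝ≥0∞) * ∫⁻ ω, ∑' i, P₁ {ω' | ∑ k ∈ Finset.range (i + 1), E k ω' ≤
            weightedMax s (Z ω) / ((n + 1 : ℕ) : ℝ)} ∂P := by
          simp_rw [hint _ _ (hAm' _)]
          rw [lintegral_tsum]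
          · refine congrArg _ (tsum_congr fun i => lintegral_congr fun ω => congrArg _ ?_)
            ext ω'
            simp only [mem_ofPred_eq]
            rw [le_div_iff₀ (by positivity)]
            simp
          · intro i
            refine Measurable.aemeasurable ?_
            refine (Monotone.measurable (f := fun u : ℝ =>
              P₁ {ω' | ∑ k ∈ Finset.range (i + 1), E k ω' ≤ u}) fun a b hab =>
                measure_mono fun ω hω => le_trans (show _ ≤ a from hω) hab).comp ?_
            exact ((measurable_weightedMax s).comp hZ).coe_nnreal_real.div_const _
      _ ≤ ((n + 1 : ℕ) : ℝ≥0∞) * ∫⁻ ω, ENNReal.ofReal (weightedMax s (Z ω) / ((n + 1 : ℕ) : ℝ)) ∂P := by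
          gcongr with ω
          rw [ENNReal.tsum_eq_iSup_nat]
          exact iSup_le fun N => sum_measure_arrival_le hX.measurable_exp hX.law_exp hX.indep_exp N _
      _ = _ := by
          rw [← lintegral_const_mul' _ _ (by simp)]
          refine lintegral_congr fun ω => ?_
          rw [← ENNReal.ofReal_natCast, ← ENNReal.ofReal_mul (by positivity),
            mul_div_cancel₀ _ (by positivity), ENNReal.ofReal_coe_nnreal]

/-- A shift of the path can be moved into the points of the weighted maximum; the tails on the
max-stable side then agree by stationarity. -/
lemma lintegral_weightedMax_shift {d : ℕ} {Ω Ω₁ : Type*} [MeasurableSpace Ω]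
    [MeasurableSpace Ω₁] {P : Measure Ω} [IsProbabilityMeasure P] {P₁ : Measure Ω₁}
    [IsProbabilityMeasure P₁] {Z : Ω → FieldPath d} (hZ : Measurable Z)
    {E : ℕ → Ω₁ → ℝ} {Zc : ℕ → Ω₁ → FieldPath d} (hX : IsDeHaanInput P Z P₁ E Zc)
    (hstat : IsStationaryField P₁ (deHaanField E Zc))
    (s : Finset ((Fin d → ℝ) × ℝ≥0)) (h : Fin d → ℝ) :
    ∫⁻ ω, (weightedMax s (fun t => Z ω (t + h)) : ℝ≥0∞) ∂P
      = ∫⁻ ω, (weightedMax s (Z ω) : ℝ≥0∞) ∂P := by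
  classical
  have hXm : ∀ t, Measurable fun ω => deHaanField E Zc ω t := fun t => by
    unfold deHaanField
    refine Measurable.iSup fun i => Measurable.div ?_ ?_
    · exact ((measurable_pi_apply t).comp (hX.measurable_copy i)).coe_nnreal_ennreal
    · exact ENNReal.measurable_ofReal.comp (Finset.measurable_sum _ fun k _ => hX.measurable_exp k)
  have hsh : ∀ f : FieldPath d, weightedMax s (fun t => f (t + h))
      = weightedMax (s.image fun p => (p.1 + h, p.2)) f := fun f => by
    simp [weightedMax, Finset.sup_image, Function.comp_def]
  have hsh' : ∀ f, weightedMaxENN (s.image fun p => (p.1 + h, p.2)) f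
      = weightedMaxENN s (fun t => f (t + h)) := fun f => by
    simp [weightedMaxENN, Finset.sup_image, Function.comp_def]
  simp_rw [hsh]
  rw [lintegral_weightedMax_eq_liminf hZ hX, lintegral_weightedMax_eq_liminf hZ hX]
  refine congrArg (fun g => liminf g atTop) (funext fun n => congrArg _ ?_)
  simp_rw [hsh']
  have hm : MeasurableSet {f : (Fin d → ℝ) → ℝ≥0∞ | ((n + 1 : ℕ) : ℝ≥0∞) < weightedMaxENN s f} :=
    measurableSet_lt measurable_const (measurable_weightedMaxENN s)
  have := congrArg (fun ν => ν {f | ((n + 1 : ℕ) : ℝ≥0∞) < weightedMaxENN s f}) (hstat h)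
  beta_reduce at this
  rwa [Measure.map_apply (measurable_pi_lambda _ fun t => hXm _) hm,
    Measure.map_apply (measurable_pi_lambda _ fun t => hXm _) hm] at this

/-! ### The space of càdlàg paths -/

/-- The space of càdlàg paths, with the trace of the product σ-field. -/
abbrev CadlagPath (d : ℕ) : Type := {f : FieldPath d // IsCadlag f}

lemma IsCadlag.const_mul {d : ℕ} {f : FieldPath d} (hf : IsCadlag f) (c : ℝ≥0) :
    IsCadlag fun t => c * f t := fun t =>
  ⟨fun ρ => ((hf t).1 ρ).imp' (fun l => c * l) fun _ hl => hl.const_mul c, (hf t).2.const_mul c⟩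

lemma IsCadlag.comp_add {d : ℕ} {f : FieldPath d} (hf : IsCadlag f) (τ : Fin d → ℝ) :
    IsCadlag fun t => f (t + τ) := by
  intro t
  have hcont : Tendsto (fun s : Fin d → ℝ => s + τ) (𝓝 t) (𝓝 (t + τ)) :=
    (continuous_add_const τ).tendsto t
  refine ⟨fun ρ => ((hf (t + τ)).1 ρ).imp fun l hl => hl.comp ?_, (hf (t + τ)).2.tendsto.comp ?_⟩
  · refine tendsto_nhdsWithin_iff.2 ⟨hcont.mono_left nhdsWithin_le_nhds, ?_⟩
    filter_upwards [self_mem_nhdsWithin] with s hs i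
    have := hs i
    split_ifs with h <;> simpa [h] using this
  · refine tendsto_nhdsWithin_iff.2 ⟨hcont.mono_left nhdsWithin_le_nhds, ?_⟩
    filter_upwards [self_mem_nhdsWithin] with s hs
    exact add_le_add_left (show t ≤ s from hs) τ

namespace CadlagPath

variable {d : ℕ}

/-- The path multiplied by a constant. -/
def scale (c : ℝ≥0) (f : CadlagPath d) : CadlagPath d := ⟨fun t => c * f.1 t, f.2.const_mul c⟩

/-- The translated path. -/
def shift (τ : Fin d → ℝ) (f : CadlagPath d) : CadlagPath d := ⟨fun t => f.1 (t + τ), f.2.comp_add τ⟩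

@[simp] lemma scale_apply (c : ℝ≥0) (f : CadlagPath d) (t : Fin d → ℝ) :
    (scale c f).1 t = c * f.1 t := rfl

@[simp] lemma shift_apply (τ : Fin d → ℝ) (f : CadlagPath d) (t : Fin d → ℝ) :
    (shift τ f).1 t = f.1 (t + τ) := rfl

lemma shift_shift (σ τ : Fin d → ℝ) (f : CadlagPath d) : shift σ (shift τ f) = shift (σ + τ) f := by
  ext t; simp [add_assoc]

@[simp] lemma shift_zero (f : CadlagPath d) : shift 0 f = f := by
  ext t; simp

lemma shift_scale (c : ℝ≥0) (τ : Fin d → ℝ) (f : CadlagPath d) :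
    shift τ (scale c f) = scale c (shift τ f) := rfl

@[fun_prop]
lemma measurable_apply (t : Fin d → ℝ) : Measurable fun f : CadlagPath d => f.1 t :=
  (measurable_pi_apply t).comp measurable_subtype_coe

@[fun_prop]
lemma measurable_shift (τ : Fin d → ℝ) : Measurable (shift τ : CadlagPath d → CadlagPath d) :=
  Measurable.subtype_mk (measurable_pi_lambda _ fun _ => measurable_apply _)

lemma measurable_scale_uncurry :
    Measurable fun p : ℝ≥0 × CadlagPath d => scale p.1 p.2 :=
  Measurable.subtype_mk (measurable_pi_lambda _ fun t =>
    measurable_fst.mul ((measurable_apply t).comp measurable_snd))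

/-- The smallest point of `(n + 1)⁻¹ ℤᵈ` above `t`. -/
noncomputable def gridCeil (n : ℕ) (t : Fin d → ℝ) : Fin d → ℝ :=
  fun i => (⌈((n : ℝ) + 1) * t i⌉ : ℤ) / ((n : ℝ) + 1)

lemma le_gridCeil (n : ℕ) (t : Fin d → ℝ) : t ≤ gridCeil n t := fun i => by
  have : (0 : ℝ) < (n : ℝ) + 1 := by positivity
  rw [gridCeil, le_div_iff₀ this, mul_comm]
  exact Int.le_ceil _

lemma tendsto_gridCeil (t : Fin d → ℝ) : Tendsto (fun n => gridCeil n t) atTop (𝓝[Ici t] t) := by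
  refine tendsto_nhdsWithin_iff.2 ⟨tendsto_pi_nhds.2 fun i => ?_, Eventually.of_forall fun n =>
    le_gridCeil n t⟩
  have h1 : Tendsto (fun n : ℕ => t i + 1 / ((n : ℝ) + 1)) atTop (𝓝 (t i)) := by
    simpa using tendsto_one_div_add_atTop_nhds_zero_nat.const_add (t i)
  refine tendsto_of_tendsto_of_tendsto_of_le_of_le tendsto_const_nhds h1 (fun n => le_gridCeil n t i)
    fun n => ?_
  have : (0 : ℝ) < (n : ℝ) + 1 := by positivity
  change _ / _ ≤ _
  rw [div_le_iff₀ this, add_mul (t i), one_div, inv_mul_cancel₀ this.ne', mul_comm (t i)]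
  exact (Int.ceil_lt_add_one _).le

lemma tendsto_apply_gridCeil (f : CadlagPath d) (t : Fin d → ℝ) :
    Tendsto (fun n => f.1 (gridCeil n t)) atTop (𝓝 (f.1 t)) :=
  ((f.2 t).2.tendsto).comp (tendsto_gridCeil t)

/-- A path is the pointwise limit of its values at grid points from above, and each grid is
countable. This joint measurability is what makes Tonelli available later. -/
lemma measurable_eval : Measurable fun p : CadlagPath d × (Fin d → ℝ) => p.1.1 p.2 := by
  refine measurable_of_tendsto_metrizable
    (f := fun n (p : CadlagPath d × (Fin d → ℝ)) => p.1.1 (gridCeil n p.2)) (fun n => ?_)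
    (tendsto_pi_nhds.2 fun p => tendsto_apply_gridCeil p.1 p.2)
  have h1 : Measurable fun q : CadlagPath d × (Fin d → ℤ) =>
      q.1.1 (fun i => (q.2 i : ℝ) / ((n : ℝ) + 1)) :=
    measurable_from_prod_countable_left fun k =>
      measurable_apply fun i => (k i : ℝ) / ((n : ℝ) + 1)
  have h2 : Measurable fun p : CadlagPath d × (Fin d → ℝ) =>
      (p.1, fun i => ⌈((n : ℝ) + 1) * p.2 i⌉) := by
    refine measurable_fst.prodMk (measurable_pi_lambda _ fun i => ?_)
    exact Int.measurable_ceil.comp (((measurable_pi_apply i).comp measurable_snd).const_mul _)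
  exact h1.comp h2

lemma measurable_coe (f : CadlagPath d) : Measurable f.1 :=
  measurable_eval.comp measurable_prodMk_left

/-- A random field with almost surely càdlàg paths has a measurable modification with values in the
space of càdlàg paths. -/
lemma exists_modification {Ω : Type*} [MeasurableSpace Ω] {P : Measure Ω} {Z : Ω → FieldPath d}
    (hZ : Measurable Z) (hc : ∀ᵐ ω ∂P, IsCadlag (Z ω)) :
    ∃ Y : Ω → CadlagPath d, Measurable Y ∧ ∀ᵐ ω ∂P, (Y ω).1 = Z ω := by
  classical
  obtain ⟨N, hN, hNm, hN0⟩ := exists_measurable_superset_of_null (ae_iff.1 hc)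
  have h0 : IsCadlag (fun _ : Fin d → ℝ => (0 : ℝ≥0)) := fun t =>
    ⟨fun ρ => ⟨0, tendsto_const_nhds⟩, continuousWithinAt_const⟩
  have hcad : ∀ ω, IsCadlag (if ω ∈ N then fun _ => 0 else Z ω) := fun ω => by
    split_ifs with h
    · exact h0
    · by_contra h'
      exact h (hN h')
  refine ⟨fun ω => ⟨_, hcad ω⟩, Measurable.subtype_mk (Measurable.ite hNm measurable_const hZ), ?_⟩
  filter_upwards [measure_eq_zero_iff_ae_notMem.1 hN0] with ω hω
  simp [hω]

lemma measure_ext {μ ν : Measure (CadlagPath d)}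
    (h : μ.map Subtype.val = ν.map Subtype.val) : μ = ν := by
  ext A hA
  obtain ⟨B, hB, rfl⟩ := hA
  rw [← Measure.map_apply measurable_subtype_coe hB, h, Measure.map_apply measurable_subtype_coe hB]

end CadlagPath

/-! ### Shift invariance of homogeneous functionals -/

/-- This is the right derivative at `c = 1` of `c ↦ ∫ max (c Y) m`, by domination with `Y`. Being a
derivative from the right, it includes the ties `m = Y`, as the closed generating sets `weightedMax
s f ≤ 1` require. -/
lemma tendsto_difference_quotient_lintegral_max {α : Type*} [MeasurableSpace α] {μ : Measure α}
    {Y m : α → ℝ≥0} (hY : Measurable Y) (hm : Measurable m) (hYi : ∫⁻ a, Y a ∂μ ≠ ∞)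
    (hmi : ∫⁻ a, m a ∂μ ≠ ∞) :
    Tendsto (fun n : ℕ => ((n + 1 : ℕ) : ℝ≥0∞) *
      (∫⁻ a, (max ((1 + 1 / ((n + 1 : ℕ) : ℝ≥0)) * Y a) (m a) : ℝ≥0) ∂μ
        - ∫⁻ a, (max (1 * Y a) (m a) : ℝ≥0) ∂μ)) atTop
      (𝓝 (∫⁻ a in {a | m a ≤ Y a}, Y a ∂μ)) := by
  have hfin : ∫⁻ a, (max (1 * Y a) (m a) : ℝ≥0) ∂μ ≠ ∞ := by
    refine ne_top_of_le_ne_top (ENNReal.add_ne_top.2 ⟨hYi, hmi⟩) ?_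
    rw [← lintegral_add_left hY.coe_nnreal_ennreal]
    refine lintegral_mono fun a => ?_
    rw [← ENNReal.coe_add, one_mul]
    exact ENNReal.coe_le_coe.2 (max_le (by simp) (by simp))
  have heq : ∀ n : ℕ, ((n + 1 : ℕ) : ℝ≥0∞) *
      (∫⁻ a, (max ((1 + 1 / ((n + 1 : ℕ) : ℝ≥0)) * Y a) (m a) : ℝ≥0) ∂μ
        - ∫⁻ a, (max (1 * Y a) (m a) : ℝ≥0) ∂μ) = ∫⁻ a, ((((n + 1 : ℕ) : ℝ≥0) *
      (max ((1 + 1 / ((n + 1 : ℕ) : ℝ≥0)) * Y a) (m a) - max (1 * Y a) (m a)) : ℝ≥0) : ℝ≥0∞) ∂μ := by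
    intro n
    rw [← lintegral_sub (by fun_prop) hfin, ← lintegral_const_mul' _ _ (by simp)]
    · simp
    · refine Eventually.of_forall fun a => ENNReal.coe_le_coe.2 (max_le_max ?_ le_rfl)
      gcongr
      simp
  simp_rw [heq]
  rw [← lintegral_indicator (measurableSet_le hm hY)]
  refine tendsto_lintegral_of_dominated_convergence (fun a => (Y a : ℝ≥0∞)) (fun n => by fun_prop)
    (fun n => Eventually.of_forall fun a => ENNReal.coe_le_coe.2 ?_) hYi
    (Eventually.of_forall fun a => ?_)
  · have hn : (((n + 1 : ℕ) : ℝ≥0)) ≠ 0 := by positivity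
    calc _ ≤ ((n + 1 : ℕ) : ℝ≥0) * (1 / ((n + 1 : ℕ) : ℝ≥0) * Y a) := by
          gcongr
          rw [tsub_le_iff_right, add_mul, one_mul]
          refine max_le ?_ ?_
          · rw [add_comm]
            gcongr
            exact le_max_left _ _
          · exact (le_max_right _ _).trans le_add_self
      _ = Y a := by rw [← mul_assoc, mul_one_div_cancel hn, one_mul]
  · by_cases h : m a ≤ Y a
    · rw [indicator_of_mem (by exact h)]
      refine tendsto_const_nhds.congr fun n => ?_
      have hn : (((n + 1 : ℕ) : ℝ≥0)) ≠ 0 := by positivity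
      rw [one_mul, max_eq_left h, max_eq_left (h.trans (le_mul_of_one_le_left' (by simp))), add_mul,
        one_mul, add_tsub_cancel_left, ← mul_assoc, mul_one_div_cancel hn, one_mul]
    · rw [indicator_of_notMem (by exact h)]
      push Not at h
      refine tendsto_const_nhds.congr' ?_
      have hlim : Tendsto (fun n : ℕ => (1 + 1 / ((n + 1 : ℕ) : ℝ≥0)) * Y a) atTop
          (𝓝 ((1 + 0) * Y a)) := by
        refine Tendsto.mul_const _ (Tendsto.const_add _ ?_)
        simp_rw [one_div]
        exact (tendsto_inv_atTop_nhds_zero_nat (𝕜 := ℝ≥0)).comp (tendsto_add_atTop_nat 1)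
      rw [add_zero, one_mul] at hlim
      filter_upwards [hlim.eventually (gt_mem_nhds h)] with n hn
      rw [max_eq_right hn.le, max_eq_right (by rw [one_mul]; exact h.le)]
      simp

lemma isPiSystem_weightedMax_le (d : ℕ) :
    IsPiSystem {S : Set (FieldPath d) | ∃ s, S = {f | weightedMax s f ≤ 1}} := by
  classical
  rintro _ ⟨s, rfl⟩ _ ⟨s', rfl⟩ -
  refine ⟨s ∪ s', ?_⟩
  ext f
  simp [weightedMax, Finset.sup_union]

lemma generateFrom_weightedMax_le (d : ℕ) :
    (MeasurableSpace.pi : MeasurableSpace (FieldPath d)) =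
      MeasurableSpace.generateFrom {S | ∃ s, S = {f | weightedMax s f ≤ 1}} := by
  apply le_antisymm
  · refine iSup_le fun t => ?_
    rw [← measurable_iff_comap_le]
    have hpos : ∀ c : ℝ≥0, 0 < c → MeasurableSet[MeasurableSpace.generateFrom
        {S : Set (FieldPath d) | ∃ s, S = {f | weightedMax s f ≤ 1}}] {f | f t ≤ c} := by
      intro c hc
      refine MeasurableSpace.measurableSet_generateFrom ⟨{(t, c⁻¹)}, ?_⟩
      ext f
      simp [weightedMax, inv_mul_le_iff₀ hc]
    refine @measurable_of_Iic ℝ≥0 (FieldPath d) _ _ _ (_) _ _ _ _ fun c => ?_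
    -- The weight `c⁻¹` only expresses levels `c > 0`, so level `0` has to be approached from above.
    have : (fun f : FieldPath d => f t) ⁻¹' Iic c = ⋂ n : ℕ, {f | f t ≤ c + 1 / ((n : ℝ≥0) + 1)} := by
      ext f
      simp only [mem_preimage, mem_Iic, mem_iInter, mem_ofPred_eq]
      refine ⟨fun h n => h.trans (by simp), fun h => ?_⟩
      refine ge_of_tendsto' (f := fun n : ℕ => c + 1 / ((n : ℝ≥0) + 1)) (x := atTop) ?_ h
      simpa using (tendsto_one_div_add_atTop_nhds_zero_nat (𝕜 := ℝ≥0)).const_add c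
    rw [this]
    exact MeasurableSet.iInter fun n => hpos _ (by positivity)
  · refine MeasurableSpace.generateFrom_le ?_
    rintro _ ⟨s, rfl⟩
    exact measurableSet_le (measurable_weightedMax s) measurable_const

namespace CadlagPath

variable {d : ℕ}

/-- The assumptions on the law of the spectral field that the shift argument needs. -/
structure IsMaxInvariant (μ : Measure (CadlagPath d)) : Prop where
  mean_one : ∀ t, ∫⁻ f, (f.1 t : ℝ≥0∞) ∂μ = 1
  nonzero : ∀ᵐ f ∂μ, ∃ t, 0 < f.1 t
  max_shift : ∀ s h, ∫⁻ f, (weightedMax s (shift h f).1 : ℝ≥0∞) ∂μ = ∫⁻ f, weightedMax s f.1 ∂μ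

/-- Homogeneity of degree one. -/
def IsHomogeneous (G : CadlagPath d → ℝ≥0∞) : Prop :=
  ∀ (c : ℝ≥0) (f : CadlagPath d), 0 < c → G (scale c f) = c * G f

/-- The law of the field normalised at `t`, tilted by its value at `t`, and shifted by `τ`. -/
noncomputable def tiltedLaw (μ : Measure (CadlagPath d)) (t τ : Fin d → ℝ) : Measure (CadlagPath d) :=
  (μ.withDensity fun f => (f.1 (t + τ) : ℝ≥0∞)).map
    fun f => scale (f.1 (t + τ))⁻¹ (shift τ f)

lemma measurable_normalize (t τ : Fin d → ℝ) :
    Measurable fun f : CadlagPath d => scale (f.1 (t + τ))⁻¹ (shift τ f) :=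
  measurable_scale_uncurry.comp ((measurable_apply _).inv.prodMk (measurable_shift τ))

lemma lintegral_tiltedLaw (μ : Measure (CadlagPath d)) (t τ : Fin d → ℝ) {g : CadlagPath d → ℝ≥0∞}
    (hg : Measurable g) :
    ∫⁻ f, g f ∂(tiltedLaw μ t τ)
      = ∫⁻ f, f.1 (t + τ) * g (scale (f.1 (t + τ))⁻¹ (shift τ f)) ∂μ := by
  rw [tiltedLaw, lintegral_map hg (measurable_normalize t τ)]
  exact lintegral_withDensity_eq_lintegral_mul _ (measurable_apply _).coe_nnreal_ennreal
    (hg.comp (measurable_normalize t τ))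

lemma weightedMax_mul (s : Finset ((Fin d → ℝ) × ℝ≥0)) (c : ℝ≥0) (f : FieldPath d) :
    weightedMax s (fun t => c * f t) = c * weightedMax s f := by
  simp only [weightedMax, NNReal.mul_finset_sup]
  exact Finset.sup_congr rfl fun p _ => by ring

/-- On the generating π-system, the tilted law is the mean of `f (t + τ)` on the event that this
value dominates a weighted maximum. That mean is a derivative in a weight of shift-invariant means
of maxima. -/
lemma IsMaxInvariant.tiltedLaw_eq {μ : Measure (CadlagPath d)} (hμ : IsMaxInvariant μ)
    (t τ : Fin d → ℝ) : tiltedLaw μ t τ = tiltedLaw μ t 0 := by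
  classical
  have huniv : ∀ τ, tiltedLaw μ t τ univ = 1 := fun τ => by
    rw [← lintegral_one, lintegral_tiltedLaw μ t τ measurable_const]
    simp [hμ.mean_one]
  have hset : ∀ τ (s : Finset ((Fin d → ℝ) × ℝ≥0)),
      ((tiltedLaw μ t τ).map Subtype.val) {f | weightedMax s f ≤ 1} =
      ∫⁻ f in {f : CadlagPath d | weightedMax s (shift τ f).1 ≤ f.1 (t + τ)}, f.1 (t + τ) ∂μ := by
    intro τ s
    have hms : MeasurableSet {f : FieldPath d | weightedMax s f ≤ 1} :=
      measurableSet_le (measurable_weightedMax s) measurable_const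
    have hms' : MeasurableSet {f : CadlagPath d | weightedMax s (shift τ f).1 ≤ f.1 (t + τ)} :=
      measurableSet_le ((measurable_weightedMax s).comp
        (measurable_subtype_coe.comp (measurable_shift τ))) (measurable_apply _)
    rw [Measure.map_apply measurable_subtype_coe hms, ← lintegral_indicator_one
      (measurable_subtype_coe hms), lintegral_tiltedLaw μ t τ (measurable_one.indicator
      (measurable_subtype_coe hms)), ← lintegral_indicator hms']
    refine lintegral_congr fun f => ?_
    rcases eq_or_ne (f.1 (t + τ)) 0 with h0 | h0
    · simp [h0, indicator]
    · have hiff : scale (f.1 (t + τ))⁻¹ (shift τ f) ∈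
          (Subtype.val ⁻¹' {f : FieldPath d | weightedMax s f ≤ 1} : Set (CadlagPath d)) ↔
          f ∈ {f : CadlagPath d | weightedMax s (shift τ f).1 ≤ f.1 (t + τ)} := by
        change weightedMax s (fun u => (f.1 (t + τ))⁻¹ * (shift τ f).1 u) ≤ 1 ↔ _
        rw [weightedMax_mul, inv_mul_le_iff₀ (pos_iff_ne_zero.2 h0), mul_one]
        rfl
      by_cases h : f ∈ {f : CadlagPath d | weightedMax s (shift τ f).1 ≤ f.1 (t + τ)}
      · rw [indicator_of_mem h, indicator_of_mem (hiff.2 h)]; simp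
      · rw [indicator_of_notMem h, indicator_of_notMem (mt hiff.1 h)]; simp
  have hfin : IsFiniteMeasure ((tiltedLaw μ t τ).map Subtype.val) := ⟨by
    rw [Measure.map_apply measurable_subtype_coe MeasurableSet.univ, preimage_univ, huniv]
    exact ENNReal.one_lt_top⟩
  have hwfin : ∀ s, ∫⁻ f : CadlagPath d, (weightedMax s f.1 : ℝ≥0∞) ∂μ ≠ ∞ := by
    intro s
    have hle : ∀ f : CadlagPath d, (weightedMax s f.1 : ℝ≥0∞) ≤ ∑ p ∈ s, (p.2 : ℝ≥0∞) * f.1 p.1 := by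
      intro f
      rw [coe_weightedMax]
      exact Finset.sup_le fun p hp => Finset.single_le_sum
        (f := fun p : (Fin d → ℝ) × ℝ≥0 => (p.2 : ℝ≥0∞) * f.1 p.1) (fun _ _ => zero_le) hp
    refine ne_top_of_le_ne_top ?_ (lintegral_mono hle)
    rw [lintegral_finsetSum _ fun p _ => by fun_prop]
    refine ENNReal.sum_ne_top.2 fun p _ => ?_
    rw [lintegral_const_mul' _ _ (by simp), hμ.mean_one]
    simp
  refine measure_ext (ext_of_generate_finite _ (generateFrom_weightedMax_le d)
    (isPiSystem_weightedMax_le d) ?_ ?_)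
  · rintro _ ⟨s, rfl⟩
    rw [hset, hset]
    have hlim : ∀ τ, _ := fun τ => tendsto_difference_quotient_lintegral_max (μ := μ)
      (Y := fun f : CadlagPath d => f.1 (t + τ)) (m := fun f => weightedMax s (shift τ f).1)
      (measurable_apply _) ((measurable_weightedMax s).comp
        (measurable_subtype_coe.comp (measurable_shift τ))) (by rw [hμ.mean_one]; simp)
        (by rw [hμ.max_shift]; exact hwfin s)
    -- Inserting the point `t` with weight `c` makes the maximum itself a weighted maximum of the
    -- shifted path, whose mean does not depend on `τ`.
    have hmax : ∀ τ (c : ℝ≥0), ∫⁻ f : CadlagPath d,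
        (max (c * f.1 (t + τ)) (weightedMax s (shift τ f).1) : ℝ≥0) ∂μ
          = ∫⁻ f, weightedMax (insert (t, c) s) f.1 ∂μ := by
      intro τ c
      rw [← hμ.max_shift _ τ]
      simp [weightedMax, Finset.sup_insert]
    refine tendsto_nhds_unique (hlim τ) ?_
    refine (hlim 0).congr fun n => ?_
    simp only [hmax]
  · rw [Measure.map_apply measurable_subtype_coe MeasurableSet.univ,
      Measure.map_apply measurable_subtype_coe MeasurableSet.univ, preimage_univ, huniv, huniv]

lemma exists_rat_pos (f : CadlagPath d) (h : ∃ t, 0 < f.1 t) :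
    ∃ q : Fin d → ℚ, 0 < f.1 (fun i => (q i : ℝ)) := by
  obtain ⟨t, ht⟩ := h
  obtain ⟨n, hn⟩ := ((tendsto_apply_gridCeil f t).eventually (lt_mem_nhds ht)).exists
  refine ⟨fun i => (⌈((n : ℝ) + 1) * t i⌉ : ℤ) / ((n : ℚ) + 1), ?_⟩
  convert hn using 2
  ext i
  simp [gridCeil]

/-- Expectations of homogeneous functionals are shift invariant. -/
theorem IsMaxInvariant.lintegral_shift {μ : Measure (CadlagPath d)} (hμ : IsMaxInvariant μ)
    {G : CadlagPath d → ℝ≥0∞} (hG : Measurable G) (hh : IsHomogeneous G) (τ : Fin d → ℝ) :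
    ∫⁻ f, G (shift τ f) ∂μ = ∫⁻ f, G f ∂μ := by
  obtain ⟨e, he⟩ := exists_surjective_nat (Fin d → ℚ)
  set t : ℕ → Fin d → ℝ := fun k i => (e k i : ℝ) with ht
  -- Paths are sorted by the first rational point where they are positive. Right continuity ensures
  -- that nonzero paths have one, and on `B k` the path can be normalised at `t k`.
  set B : ℕ → Set (CadlagPath d) := fun k => {f | (∀ j < k, f.1 (t j) = 0) ∧ 0 < f.1 (t k)} with hB
  have hBm : ∀ k, MeasurableSet (B k) := fun k => by
    have h1 : B k = (⋂ j ∈ Iio k, {f : CadlagPath d | f.1 (t j) = 0}) ∩ {f | 0 < f.1 (t k)} := by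
      ext f; simp [hB]
    rw [h1]
    exact (MeasurableSet.biInter (to_countable _) fun j _ =>
      measurableSet_eq_fun (measurable_apply _) measurable_const).inter
      (measurableSet_lt measurable_const (measurable_apply _))
  have hBdisj : ∀ j k f, f ∈ B j → f ∈ B k → j ≤ k := fun j k f hj hk => by
    by_contra h
    exact hk.2.ne' (hj.1 k (not_le.1 h))
  have hBhom : ∀ k (c : ℝ≥0) f, 0 < c → (scale c f ∈ B k ↔ f ∈ B k) := by
    intro k c f hc
    simp [hB, hc.ne', hc]
  have hdecomp : ∀ τ, ∫⁻ f, G (shift τ f) ∂μ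
      = ∑' k, ∫⁻ f, (B k).indicator G (shift τ f) ∂μ := by
    intro τ
    have hm : ∀ k, AEMeasurable (fun f => (B k).indicator G (shift τ f)) μ := fun k =>
      ((hG.indicator (hBm k)).comp (measurable_shift τ)).aemeasurable
    rw [← lintegral_tsum hm]
    refine lintegral_congr_ae ?_
    filter_upwards [hμ.nonzero] with f ⟨u, hu⟩
    obtain ⟨q, hq⟩ := exists_rat_pos (shift τ f) ⟨u - τ, by simpa using hu⟩
    have hex : ∃ k, 0 < (shift τ f).1 (t k) := by
      obtain ⟨k, rfl⟩ := he q
      exact ⟨k, hq⟩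
    classical
    have hmem : shift τ f ∈ B (Nat.find hex) :=
      ⟨fun j hj => nonpos_iff_eq_zero.1 (not_lt.1 (Nat.find_min hex hj)), Nat.find_spec hex⟩
    rw [tsum_eq_single (Nat.find hex), indicator_of_mem hmem]
    exact fun k hk => indicator_of_notMem (fun h => hk
      (le_antisymm (hBdisj _ _ _ h hmem) (hBdisj _ _ _ hmem h))) _
  have hmain : ∀ τ k, ∫⁻ f, (B k).indicator G (shift τ f) ∂μ
      = ∫⁻ f, (B k).indicator G f ∂(tiltedLaw μ (t k) τ) := by
    intro τ k
    rw [lintegral_tiltedLaw _ _ _ (hG.indicator (hBm k))]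
    refine lintegral_congr fun f => ?_
    rcases eq_or_ne (f.1 (t k + τ)) 0 with h0 | h0
    · rw [indicator_of_notMem, h0]
      · simp
      · exact fun h => h.2.ne' h0
    · have hc : 0 < (f.1 (t k + τ))⁻¹ := inv_pos.2 (pos_iff_ne_zero.2 h0)
      by_cases hmem : shift τ f ∈ B k
      · rw [indicator_of_mem hmem, indicator_of_mem ((hBhom k _ _ hc).2 hmem), hh _ _ hc, ← mul_assoc,
          ← ENNReal.coe_mul, mul_inv_cancel₀ h0, ENNReal.coe_one, one_mul]
      · rw [indicator_of_notMem hmem, indicator_of_notMem (mt (hBhom k _ _ hc).1 hmem), mul_zero]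
  have h0 := hdecomp 0
  simp only [shift_zero] at h0
  rw [hdecomp τ, h0]
  refine tsum_congr fun k => ?_
  have := hmain 0 k
  simp only [shift_zero] at this
  rw [hmain, this, hμ.tiltedLaw_eq]

end CadlagPath

/-! ### The measures `λ_δ` and the sojourn functionals -/

instance sFinite_lam (d : ℕ) (δ : ℝ≥0) : SFinite (lam d δ) := by
  unfold lam
  split_ifs <;> infer_instance

lemma lam_zero (d : ℕ) : lam d 0 = volume := if_pos rfl

lemma lam_apply_of_ne_zero {d : ℕ} {δ : ℝ≥0} (hδ : δ ≠ 0) {A : Set (Fin d → ℝ)}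
    (hA : MeasurableSet A) :
    lam d δ A = (δ : ℝ≥0∞) ^ d * ∑' k : Fin d → ℤ, A.indicator 1 (fun i => (δ : ℝ) * (k i : ℝ)) := by
  rw [lam, if_neg hδ, Measure.smul_apply, Measure.sum_apply _ hA, smul_eq_mul]
  simp_rw [Measure.dirac_apply' _ hA]

/-- The translations that preserve `λ_δ`. -/
def IsLamShift (d : ℕ) (δ : ℝ≥0) (τ : Fin d → ℝ) : Prop :=
  MeasurePreserving (fun t => t + τ) (lam d δ) (lam d δ)

lemma isLamShift_zero {d : ℕ} (τ : Fin d → ℝ) : IsLamShift d 0 τ := by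
  rw [IsLamShift, lam_zero]
  exact measurePreserving_add_right volume τ

lemma isLamShift_lattice {d : ℕ} {δ : ℝ≥0} (hδ : δ ≠ 0) (j : Fin d → ℤ) :
    IsLamShift d δ (fun i => (δ : ℝ) * (j i : ℝ)) := by
  have hm : Measurable fun t : Fin d → ℝ => t + fun i => (δ : ℝ) * (j i : ℝ) := by fun_prop
  refine ⟨hm, Measure.ext fun A hA => ?_⟩
  rw [Measure.map_apply hm hA, lam_apply_of_ne_zero hδ (hm hA), lam_apply_of_ne_zero hδ hA,
    ← (Equiv.addRight j).tsum_eq fun k : Fin d → ℤ =>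
      A.indicator (1 : (Fin d → ℝ) → ℝ≥0∞) (fun i => (δ : ℝ) * (k i : ℝ))]
  congr 1
  refine tsum_congr fun k => ?_
  have : (fun i => (δ : ℝ) * (((Equiv.addRight j) k) i : ℝ))
      = (fun i => (δ : ℝ) * (k i : ℝ)) + fun i => (δ : ℝ) * (j i : ℝ) := by
    ext i; simp [mul_add]
  rw [this]
  rfl

/-- For `δ > 0` the measure only charges lattice points. This lets an integral over a cube be moved
to the origin uniformly in `δ`. -/
lemma ae_isLamShift (d : ℕ) (δ : ℝ≥0) : ∀ᵐ t ∂(lam d δ), IsLamShift d δ t := by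
  rcases eq_or_ne δ 0 with rfl | hδ
  · exact Eventually.of_forall isLamShift_zero
  · rw [lam, if_neg hδ]
    refine Measure.ae_smul_measure ?_ _
    rw [Measure.ae_sum_iff]
    intro k
    rw [ae_dirac_eq]
    exact isLamShift_lattice hδ k

/-- The side of the cubes: `δ`, or `1` when `δ = 0`. -/
noncomputable def cubeSide (δ : ℝ≥0) : ℝ≥0 := if δ = 0 then 1 else δ

lemma cubeSide_pos (δ : ℝ≥0) : 0 < cubeSide δ := by
  unfold cubeSide
  split_ifs with h
  · exact one_pos
  · exact pos_iff_ne_zero.2 h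

/-- The lattice point with index `k`. -/
noncomputable def latticePoint {d : ℕ} (h : ℝ≥0) (k : Fin d → ℤ) : Fin d → ℝ :=
  fun i => (h : ℝ) * (k i : ℝ)

lemma latticePoint_add {d : ℕ} (h : ℝ≥0) (j k : Fin d → ℤ) :
    latticePoint h (j + k) = latticePoint h j + latticePoint h k := by
  ext i; simp [latticePoint, mul_add]

@[simp] lemma latticePoint_zero {d : ℕ} (h : ℝ≥0) : latticePoint h (0 : Fin d → ℤ) = 0 := by
  ext i; simp [latticePoint]

lemma isLamShift_latticePoint {d : ℕ} (δ : ℝ≥0) (k : Fin d → ℤ) :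
    IsLamShift d δ (latticePoint (cubeSide δ) k) := by
  rcases eq_or_ne δ 0 with rfl | hδ
  · exact isLamShift_zero _
  · rw [cubeSide, if_neg hδ]
    exact isLamShift_lattice hδ k

/-- The index of the cube of side `h` that contains `t`. -/
noncomputable def cubeIndex {d : ℕ} (h : ℝ≥0) (t : Fin d → ℝ) : Fin d → ℤ := fun i => ⌊t i / h⌋

lemma measurable_cubeIndex {d : ℕ} (h : ℝ≥0) : Measurable (cubeIndex (d := d) h) :=
  measurable_pi_lambda _ fun i => Int.measurable_floor.comp ((measurable_pi_apply i).div_const _)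

lemma cubeIndex_add_latticePoint {d : ℕ} {h : ℝ≥0} (hh : 0 < h) (t : Fin d → ℝ) (k : Fin d → ℤ) :
    cubeIndex h (t + latticePoint h k) = cubeIndex h t + k := by
  ext i
  have : (h : ℝ) ≠ 0 := by exact_mod_cast hh.ne'
  simp [cubeIndex, latticePoint, add_div, mul_div_cancel_left₀ _ this]

/-- The union of the cubes of side `h` with indices in `J`. -/
def cubes {d : ℕ} (h : ℝ≥0) (J : Set (Fin d → ℤ)) : Set (Fin d → ℝ) := cubeIndex h ⁻¹' J

lemma measurableSet_cubes {d : ℕ} (h : ℝ≥0) (J : Set (Fin d → ℤ)) : MeasurableSet (cubes h J) :=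
  measurable_cubeIndex h (to_countable J).measurableSet

lemma lam_cube (d : ℕ) (δ : ℝ≥0) :
    lam d δ (cubes (cubeSide δ) {0}) = (cubeSide δ : ℝ≥0∞) ^ d := by
  rcases eq_or_ne δ 0 with rfl | hδ
  · have : cubes (cubeSide 0) {0} = Set.pi univ fun _ : Fin d => Ico (0 : ℝ) 1 := by
      ext t
      simp [cubes, cubeIndex, cubeSide, funext_iff, Int.floor_eq_zero_iff, Set.mem_pi]
    rw [this, lam_zero, volume_pi_pi]
    simp [cubeSide]
  · rw [lam_apply_of_ne_zero hδ (measurableSet_cubes _ _), cubeSide, if_neg hδ, tsum_eq_single 0]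
    · rw [indicator_of_mem]
      · simp
      · simp [cubes, cubeIndex, funext_iff]
    · intro k hk
      refine indicator_of_notMem (fun h => hk ?_) _
      have h0 : cubeIndex δ (latticePoint δ k) = 0 := h
      have h1 := cubeIndex_add_latticePoint (pos_iff_ne_zero.2 hδ) 0 k
      rw [zero_add, h0] at h1
      have h2 : cubeIndex δ (0 : Fin d → ℝ) = 0 := by ext i; simp [cubeIndex]
      rw [h2, zero_add] at h1
      exact h1.symm

namespace CadlagPath

variable {d : ℕ}

/-- The functional `∫_0^∞ 𝟙(∫_{K ∩ δ ℤᵈ} 𝟙(f(t) > s) λ_δ(dt) > x) ds`. -/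
noncomputable def excess (δ : ℝ≥0) (K : Set (Fin d → ℝ)) (x : ℝ≥0) (f : CadlagPath d) : ℝ≥0∞ :=
  volume {s : ℝ | 0 < s ∧ (x : ℝ≥0∞) < sojourn δ K s f.1}

lemma measurableSet_excess {δ : ℝ≥0} {K : Set (Fin d → ℝ)} (hK : MeasurableSet K) (x : ℝ≥0) :
    MeasurableSet {p : CadlagPath d × ℝ | 0 < p.2 ∧ (x : ℝ≥0∞) < sojourn δ K p.2 p.1.1} := by
  have hA : MeasurableSet {q : (CadlagPath d × ℝ) × (Fin d → ℝ) | q.2 ∈ K ∧ q.1.2 < (q.1.1.1 q.2 : ℝ)} :=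
    (measurable_snd hK).inter (measurableSet_lt (by fun_prop)
      (measurable_eval.comp ((measurable_fst.comp measurable_fst).prodMk measurable_snd)).coe_nnreal_real)
  exact (measurableSet_lt measurable_const measurable_snd).inter
    (measurableSet_lt measurable_const (measurable_measure_prodMk_left (ν := lam d δ) hA))

lemma measurable_excess (δ : ℝ≥0) {K : Set (Fin d → ℝ)} (hK : MeasurableSet K) (x : ℝ≥0) :
    Measurable (excess δ K x) :=
  measurable_measure_prodMk_left (ν := volume) (measurableSet_excess hK x)

lemma sojourn_scale (δ : ℝ≥0) (K : Set (Fin d → ℝ)) (s : ℝ) {c : ℝ≥0} (hc : 0 < c)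
    (f : CadlagPath d) : sojourn δ K (c * s) (scale c f).1 = sojourn δ K s f.1 := by
  have : (0 : ℝ) < c := by exact_mod_cast hc
  simp [sojourn, this]

/-- Scaling the path by `c` dilates the set of admissible levels by `c`, and Lebesgue measure on the
line scales accordingly. -/
lemma isHomogeneous_excess (δ : ℝ≥0) (K : Set (Fin d → ℝ)) (x : ℝ≥0) :
    IsHomogeneous (excess δ K x) := by
  intro c f hc
  have hc' : (0 : ℝ) < c := by exact_mod_cast hc
  have h := Measure.addHaar_smul (volume : Measure ℝ) (c : ℝ)
    {s : ℝ | 0 < s ∧ (x : ℝ≥0∞) < sojourn δ K s f.1}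
  rw [Module.finrank_self, pow_one, abs_of_pos hc', ENNReal.ofReal_coe_nnreal] at h
  rw [excess, excess, ← h]
  congr 1
  ext s
  rw [mem_smul_set_iff_inv_smul_mem₀ hc'.ne', smul_eq_mul]
  simp only [mem_ofPred_eq]
  rw [← sojourn_scale δ K ((c : ℝ)⁻¹ * s) hc, mul_inv_cancel_left₀ hc'.ne',
    mul_pos_iff_of_pos_left (inv_pos.2 hc')]

lemma excess_shift {δ : ℝ≥0} {τ : Fin d → ℝ} (hτ : IsLamShift d δ τ) {K : Set (Fin d → ℝ)}
    (hK : MeasurableSet K) (x : ℝ≥0) (f : CadlagPath d) :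
    excess δ ((fun t => t + τ) ⁻¹' K) x (shift τ f) = excess δ K x f := by
  have : ∀ s, sojourn δ ((fun t => t + τ) ⁻¹' K) s (shift τ f).1 = sojourn δ K s f.1 := fun s =>
    hτ.measure_preimage (hK.inter (measurableSet_lt measurable_const
      (measurable_coe f).coe_nnreal_real)).nullMeasurableSet
  simp only [excess, this]

lemma excess_mono (δ : ℝ≥0) {K L : Set (Fin d → ℝ)} (h : K ⊆ L) (x : ℝ≥0) (f : CadlagPath d) :
    excess δ K x f ≤ excess δ L x f :=
  measure_mono fun _ hs => ⟨hs.1, hs.2.trans_le (measure_mono fun _ ht => ⟨h ht.1, ht.2⟩)⟩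

/-- At levels above `m` the sojourn is zero, hence not greater than `x`, even when `x = 0`. -/
lemma excess_le (δ : ℝ≥0) {K : Set (Fin d → ℝ)} (x : ℝ≥0) (f : CadlagPath d) {m : ℝ≥0∞}
    (h : ∀ t ∈ K, (f.1 t : ℝ≥0∞) ≤ m) : excess δ K x f ≤ m := by
  rcases eq_or_ne m ∞ with rfl | hm
  · exact le_top
  lift m to ℝ≥0 using hm
  calc excess δ K x f ≤ volume (Ioo (0 : ℝ) m) := by
        refine measure_mono fun s hs => ⟨hs.1, ?_⟩
        by_contra hsm
        have : sojourn δ K s f.1 = 0 := by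
          have hempty : {t | t ∈ K ∧ s < (f.1 t : ℝ)} = ∅ := by
            refine eq_empty_of_forall_notMem fun t ht => ?_
            have h1 : (f.1 t : ℝ) ≤ m := by exact_mod_cast h t ht.1
            exact hsm (ht.2.trans_le h1)
          rw [sojourn, hempty, measure_empty]
        exact not_lt_zero (this ▸ hs.2)
    _ = m := by rw [Real.volume_Ioo, sub_zero, ENNReal.ofReal_coe_nnreal]

lemma excess_iUnion (δ : ℝ≥0) {K : ℕ → Set (Fin d → ℝ)} (hK : Monotone K) (x : ℝ≥0)
    (f : CadlagPath d) : excess δ (⋃ n, K n) x f = ⨆ n, excess δ (K n) x f := by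
  have h1 : ∀ s, sojourn δ (⋃ n, K n) s f.1 = ⨆ n, sojourn δ (K n) s f.1 := fun s => by
    simp only [sojourn]
    rw [← Monotone.measure_iUnion]
    · congr 1
      ext t; simp
    · exact fun m n hmn t ht => ⟨hK hmn ht.1, ht.2⟩
  simp only [excess, h1]
  rw [← Monotone.measure_iUnion]
  · congr 1
    ext s; simp [lt_iSup_iff]
  · exact fun m n hmn s hs => ⟨hs.1, hs.2.trans_le (measure_mono fun t ht => ⟨hK hmn ht.1, ht.2⟩)⟩

lemma excess_eq_zero_of_totalMass (δ x : ℝ≥0) (K : Set (Fin d → ℝ)) {f : CadlagPath d}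
    (h : totalMass δ f.1 = 0) : excess δ K x f = 0 := by
  rw [totalMass, lintegral_eq_zero_iff (measurable_coe f).coe_nnreal_ennreal] at h
  have h0 : ∀ s : ℝ, 0 < s → sojourn δ K s f.1 = 0 := fun s hs => by
    refine measure_mono_null (fun t ht => ?_) (ae_iff.1 h)
    have h1 : s < f.1 t := ht.2
    have h2 : (0 : ℝ) < f.1 t := hs.trans h1
    have h3 : f.1 t ≠ 0 := by exact_mod_cast h2.ne'
    simpa using h3
  rw [excess]
  refine (congrArg volume (eq_empty_of_forall_notMem fun s hs => ?_)).trans measure_empty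
  have := hs.2
  rw [h0 s hs.1] at this
  exact not_lt_zero this

/-- Tonelli in the level and the sample point, after passing to the càdlàg modification. -/
lemma bermanOn_eq_lintegral_excess {Ω : Type*} [MeasurableSpace Ω] {P : Measure Ω} [SFinite P]
    {W : Ω → FieldPath d} {Y : Ω → CadlagPath d} (hY : Measurable Y) (hYW : ∀ᵐ ω ∂P, (Y ω).1 = W ω)
    (δ x : ℝ≥0) {K : Set (Fin d → ℝ)} (hK : MeasurableSet K) :
    bermanOn P W δ K x = ∫⁻ ω, excess δ K x (Y ω) ∂P := by
  have hA := measurableSet_excess (d := d) (δ := δ) hK x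
  have hB : MeasurableSet {p : Ω × ℝ | 0 < p.2 ∧ (x : ℝ≥0∞) < sojourn δ K p.2 (Y p.1).1} :=
    ((hY.comp measurable_fst).prodMk measurable_snd) hA
  have h1 := Measure.prod_apply (μ := P) (ν := (volume : Measure ℝ)) hB
  rw [Measure.prod_apply_symm hB] at h1
  refine Eq.trans ?_ h1
  rw [bermanOn, ← lintegral_indicator measurableSet_Ioi]
  refine lintegral_congr fun s => ?_
  by_cases hs : 0 < s
  · rw [indicator_of_mem (by exact hs)]
    refine measure_congr ?_
    filter_upwards [hYW] with ω hω
    simp only [eq_iff_iff]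
    change (x : ℝ≥0∞) < sojourn δ K s (W ω) ↔ 0 < s ∧ (x : ℝ≥0∞) < sojourn δ K s (Y ω).1
    rw [hω]
    exact (and_iff_right hs).symm
  · rw [indicator_of_notMem (by exact hs)]
    symm
    exact (congrArg P (eq_empty_of_forall_notMem fun ω hω => hs hω.1)).trans measure_empty

lemma measurable_totalMass (δ : ℝ≥0) : Measurable fun f : CadlagPath d => totalMass δ f.1 :=
  Measurable.lintegral_prod_right' (f := fun p : CadlagPath d × (Fin d → ℝ) => (p.1.1 p.2 : ℝ≥0∞))
    measurable_eval.coe_nnreal_ennreal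

lemma isHomogeneous_totalMass (δ : ℝ≥0) : IsHomogeneous fun f : CadlagPath d => totalMass δ f.1 :=
  fun c f _ => by
    simp only [totalMass, scale_apply, ENNReal.coe_mul]
    exact lintegral_const_mul' _ _ ENNReal.coe_ne_top

lemma totalMass_shift {δ : ℝ≥0} {τ : Fin d → ℝ} (hτ : IsLamShift d δ τ) (f : CadlagPath d) :
    totalMass δ (shift τ f).1 = totalMass δ f.1 :=
  hτ.lintegral_comp (measurable_coe f).coe_nnreal_ennreal

/-- By continuity from the upper quadrant, positivity at `t` extends to a small open box with corner
`t`. -/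
lemma totalMass_zero_pos {f : CadlagPath d} (h : ∃ t, 0 < f.1 t) : 0 < totalMass 0 f.1 := by
  obtain ⟨t, ht⟩ := h
  rw [pos_iff_ne_zero, totalMass, lam_zero]
  intro h0
  rw [lintegral_eq_zero_iff (measurable_coe f).coe_nnreal_ennreal] at h0
  have h1 : ∀ᶠ s in 𝓝[Ici t] t, 0 < f.1 s := (f.2 t).2.eventually (lt_mem_nhds ht)
  obtain ⟨ε, hε, hsub⟩ := Metric.mem_nhdsWithin_iff.1 h1
  have hsub' : Set.pi univ (fun i => Ioo (t i) (t i + ε)) ⊆ {s | ¬ f.1 s = 0} := by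
    intro s hs
    simp only [Set.mem_pi, mem_univ, mem_Ioo, forall_const] at hs
    refine (hsub ⟨?_, fun i => (hs i).1.le⟩).ne'
    rw [Metric.mem_ball, dist_pi_lt_iff hε]
    intro i
    rw [Real.dist_eq, abs_lt]
    constructor <;> linarith [(hs i).1, (hs i).2]
  have hpos : volume (Set.pi univ (fun i => Ioo (t i) (t i + ε))) ≠ 0 := by
    rw [volume_pi_pi]
    exact Finset.prod_ne_zero_iff.2 fun i _ => by simp [hε]
  refine hpos (measure_mono_null hsub' ?_)
  have h2 := ae_iff.1 h0
  simpa using h2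

end CadlagPath

/-! ### Averages over boxes of lattice points -/

/-- The lattice box `{0, …, n - 1}ᵈ`. -/
noncomputable def latticeBox (d n : ℕ) : Finset (Fin d → ℤ) := Fintype.piFinset fun _ => Finset.Ico 0 (n : ℤ)

/-- The lattice window `{-m, …, m}ᵈ`. -/
def latticeWindow (d m : ℕ) : Set (Fin d → ℤ) := {k | ∀ i, -(m : ℤ) ≤ k i ∧ k i ≤ m}

lemma mem_latticeBox {d n : ℕ} {k : Fin d → ℤ} : k ∈ latticeBox d n ↔ ∀ i, 0 ≤ k i ∧ k i < n := by
  simp [latticeBox]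

lemma card_latticeBox (d n : ℕ) : (latticeBox d n).card = n ^ d := by
  simp [latticeBox]

lemma tendsto_sub_two_sqrt_div (d : ℕ) :
    Tendsto (fun n : ℕ => (((n - 2 * n.sqrt : ℕ) : ℝ) / n) ^ d) atTop (𝓝 1) := by
  rw [← one_pow d]
  refine Tendsto.pow ?_ d
  have h1 : Tendsto (fun n : ℕ => 1 - 2 * (Real.sqrt n)⁻¹) atTop (𝓝 1) := by
    have h2 : Tendsto (fun n : ℕ => (Real.sqrt n)⁻¹) atTop (𝓝 0) :=
      tendsto_inv_atTop_zero.comp (Real.tendsto_sqrt_atTop.comp tendsto_natCast_atTop_atTop)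
    simpa using (h2.const_mul 2).const_sub 1
  refine tendsto_of_tendsto_of_tendsto_of_le_of_le' h1 tendsto_const_nhds ?_ ?_
  · filter_upwards [eventually_gt_atTop 0] with n hn
    have hn' : (0 : ℝ) < n := by exact_mod_cast hn
    have hs : (0 : ℝ) < Real.sqrt n := Real.sqrt_pos.2 hn'
    rw [le_div_iff₀ hn']
    have h3 : (n : ℝ) ≤ ((n - 2 * n.sqrt : ℕ) : ℝ) + 2 * (n.sqrt : ℝ) := by
      have : n ≤ (n - 2 * n.sqrt) + 2 * n.sqrt := le_tsub_add
      exact_mod_cast this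
    have h4 : (n.sqrt : ℝ) ≤ Real.sqrt n := Real.nat_sqrt_le_real_sqrt
    have h5 : (1 - 2 * (Real.sqrt n)⁻¹) * n = n - 2 * Real.sqrt n := by
      have : (n : ℝ) = Real.sqrt n * Real.sqrt n := (Real.mul_self_sqrt hn'.le).symm
      rw [sub_mul, one_mul, mul_assoc, show (Real.sqrt n)⁻¹ * (n : ℝ) = Real.sqrt n by
        rw [inv_mul_eq_iff_eq_mul₀ hs.ne']; exact this]
    linarith
  · refine Eventually.of_forall fun n => div_le_one_of_le₀ ?_ (Nat.cast_nonneg n)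
    exact_mod_cast Nat.sub_le _ _

/-- Averages over growing boxes of a function of the box seen from its points. -/
lemma tendsto_average_latticeBox {d : ℕ} {φ : Set (Fin d → ℤ) → ℝ≥0∞} {l u : ℕ → ℝ≥0∞}
    {e β : ℝ≥0∞} (he : e ≠ ∞) (hφe : ∀ J, 0 ∈ J → φ J ≤ e)
    (hl : ∀ m J, latticeWindow d m ⊆ J → l m ≤ φ J) (hu : ∀ m J, latticeWindow d m ⊆ J → φ J ≤ u m)
    (hlβ : Tendsto l atTop (𝓝 β)) (huβ : Tendsto u atTop (𝓝 β)) :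
    Tendsto (fun n : ℕ => (∑ j ∈ latticeBox d n, φ {k | k + j ∈ latticeBox d n}) / (n : ℝ≥0∞) ^ d)
      atTop (𝓝 β) := by
  classical
  -- The margin `√n` tends to infinity, so interior points see growing windows, yet it is `o(n)`, so
  -- the remaining points have vanishing proportion.
  set c : ℕ → ℝ≥0∞ := fun n => ((n - 2 * n.sqrt : ℕ) : ℝ≥0∞) ^ d with hc
  have hsub : ∀ n : ℕ, (Fintype.piFinset fun _ : Fin d => Finset.Ico (n.sqrt : ℤ) (n - n.sqrt))
      ⊆ latticeBox d n := by
    intro n k hk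
    simp only [Fintype.mem_piFinset, Finset.mem_Ico] at hk
    exact mem_latticeBox.2 fun i => by have := hk i; omega
  have hcard : ∀ n : ℕ, (Fintype.piFinset fun _ : Fin d =>
      Finset.Ico (n.sqrt : ℤ) (n - n.sqrt)).card = (n - 2 * n.sqrt) ^ d := by
    intro n
    rw [Fintype.card_piFinset]
    simp only [Int.card_Ico, Finset.prod_const, Finset.card_univ, Fintype.card_fin]
    congr 1
    omega
  have hwin : ∀ n : ℕ, ∀ j ∈ (Fintype.piFinset fun _ : Fin d => Finset.Ico (n.sqrt : ℤ) (n - n.sqrt)),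
      latticeWindow d n.sqrt ⊆ {k | k + j ∈ latticeBox d n} := by
    intro n j hj k hk
    simp only [Fintype.mem_piFinset, Finset.mem_Ico] at hj
    refine mem_latticeBox.2 fun i => ?_
    have h1 := hj i
    have h2 : -(n.sqrt : ℤ) ≤ k i ∧ k i ≤ n.sqrt := hk i
    rw [Pi.add_apply]
    omega
  have hlow : ∀ n, c n * l n.sqrt ≤ ∑ j ∈ latticeBox d n, φ {k | k + j ∈ latticeBox d n} := by
    intro n
    calc c n * l n.sqrt = ∑ j ∈ (Fintype.piFinset fun _ : Fin d =>
          Finset.Ico (n.sqrt : ℤ) (n - n.sqrt)), l n.sqrt := by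
          rw [Finset.sum_const, hcard, nsmul_eq_mul]; simp [hc]
      _ ≤ _ := (Finset.sum_le_sum fun j hj => hl _ _ (hwin n j hj)).trans
          (Finset.sum_le_sum_of_subset (hsub n))
  have hup : ∀ n, ∑ j ∈ latticeBox d n, φ {k | k + j ∈ latticeBox d n}
      ≤ (n : ℝ≥0∞) ^ d * u n.sqrt + ((n : ℝ≥0∞) ^ d - c n) * e := by
    intro n
    rw [← Finset.sum_sdiff (hsub n), add_comm]
    refine add_le_add ((Finset.sum_le_sum fun j hj => hu _ _ (hwin n j hj)).trans ?_)
      ((Finset.sum_le_sum fun j hj => hφe _ ?_).trans ?_)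
    · rw [Finset.sum_const, hcard, nsmul_eq_mul]
      gcongr
      exact_mod_cast Nat.pow_le_pow_left (Nat.sub_le _ _) d
    · simpa using (Finset.mem_sdiff.1 hj).1
    · rw [Finset.sum_const, Finset.card_sdiff_of_subset (hsub n), hcard, card_latticeBox,
        nsmul_eq_mul]
      simp [hc]
  have hr : Tendsto (fun n : ℕ => c n / (n : ℝ≥0∞) ^ d) atTop (𝓝 1) := by
    have := ENNReal.tendsto_ofReal (tendsto_sub_two_sqrt_div d)
    rw [ENNReal.ofReal_one] at this
    refine this.congr' ?_
    filter_upwards [eventually_gt_atTop 0] with n hn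
    rw [ENNReal.ofReal_pow (by positivity), ENNReal.ofReal_div_of_pos (by exact_mod_cast hn),
      ENNReal.ofReal_natCast, ENNReal.ofReal_natCast, div_eq_mul_inv, mul_pow, ← ENNReal.inv_pow,
      div_eq_mul_inv]
  have hsqrt : Tendsto Nat.sqrt atTop atTop :=
    tendsto_atTop_mono' _ (Eventually.of_forall fun n => le_rfl)
      (tendsto_atTop.2 fun m => by
        filter_upwards [eventually_ge_atTop (m * m)] with n hn
        exact Nat.le_sqrt.2 hn)
  refine tendsto_of_tendsto_of_tendsto_of_le_of_le' (g := fun n : ℕ => c n / (n : ℝ≥0∞) ^ d * l n.sqrt)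
    (h := fun n : ℕ => u n.sqrt + (1 - c n / (n : ℝ≥0∞) ^ d) * e) ?_ ?_ ?_ ?_
  · simpa using ENNReal.Tendsto.mul hr (Or.inl one_ne_zero) (hlβ.comp hsqrt) (Or.inr ENNReal.one_ne_top)
  · have h1 : Tendsto (fun n : ℕ => (1 - c n / (n : ℝ≥0∞) ^ d)) atTop (𝓝 0) := by
      simpa using ENNReal.Tendsto.sub tendsto_const_nhds hr (Or.inl ENNReal.one_ne_top)
    simpa using (huβ.comp hsqrt).add (ENNReal.Tendsto.mul_const h1 (Or.inr he))
  · refine Eventually.of_forall fun n => ?_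
    rw [← ENNReal.mul_div_right_comm]
    exact ENNReal.div_le_div_right (hlow n) _
  · filter_upwards [eventually_gt_atTop 0] with n hn
    have hn0 : (n : ℝ≥0∞) ^ d ≠ 0 := pow_ne_zero _ (by exact_mod_cast hn.ne')
    have hnt : (n : ℝ≥0∞) ^ d ≠ ∞ := ENNReal.pow_ne_top (by simp)
    refine (ENNReal.div_le_div_right (hup n) _).trans (le_of_eq ?_)
    rw [ENNReal.add_div, ENNReal.mul_div_right_comm, ENNReal.div_self hn0 hnt, one_mul,
      ENNReal.mul_div_right_comm, ENNReal.sub_div fun _ _ => hn0, ENNReal.div_self hn0 hnt]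

/-! ### Cube suprema and the first maximal cube -/

lemma exists_isMax_lex {ι : Type*} {κ : Type*} [LinearOrder κ] (g : ι → ℝ≥0∞) (r : ι → κ)
    (s : Finset ι) (hs : s.Nonempty) :
    ∃ j ∈ s, ∀ k ∈ s, g k < g j ∨ g k = g j ∧ r j ≤ r k := by
  obtain ⟨j, hj, hmax⟩ := s.exists_max_image (fun k => toLex (g k, OrderDual.toDual (r k))) hs
  refine ⟨j, hj, fun k hk => ?_⟩
  simpa [Prod.Lex.toLex_le_toLex] using hmax k hk

/-- Summability leaves only finitely many indices above a fixed positive value, and the maximum is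
sought among these. -/
lemma exists_isMax_lex_of_tsum_ne_top {ι : Type*} {κ : Type*} [LinearOrder κ] (g : ι → ℝ≥0∞)
    (r : ι → κ) (hsum : ∑' k, g k ≠ ∞) (hpos : ∃ k, 0 < g k) :
    ∃ j, ∀ k, g k < g j ∨ g k = g j ∧ r j ≤ r k := by
  obtain ⟨k₀, hk₀⟩ := hpos
  have hfin : {k | g k₀ ≤ g k}.Finite := ENNReal.finite_const_le_of_tsum_ne_top hsum hk₀.ne'
  obtain ⟨j, hj, hmax⟩ := exists_isMax_lex g r hfin.toFinset ⟨k₀, by simp⟩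
  refine ⟨j, fun k => ?_⟩
  by_cases hk : g k₀ ≤ g k
  · exact hmax k (by simpa using hk)
  · exact Or.inl ((not_le.1 hk).trans_le (by simpa using hj))

namespace CadlagPath

variable {d : ℕ}

/-- The supremum of a path over the rational points of the cube with index `k`. -/
noncomputable def cubeSup (h : ℝ≥0) (k : Fin d → ℤ) (f : CadlagPath d) : ℝ≥0∞ :=
  ⨆ q : {q : Fin d → ℚ // ∀ i, 0 ≤ q i ∧ q i < 1},
    (f.1 (latticePoint h k + fun i => (h : ℝ) * (q.1 i : ℝ)) : ℝ≥0∞)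

lemma measurable_cubeSup (h : ℝ≥0) (k : Fin d → ℤ) : Measurable (cubeSup h k) :=
  Measurable.iSup fun _ => (measurable_apply _).coe_nnreal_ennreal

lemma cubeSup_scale (h : ℝ≥0) (k : Fin d → ℤ) (c : ℝ≥0) (f : CadlagPath d) :
    cubeSup h k (scale c f) = c * cubeSup h k f := by
  simp [cubeSup, ENNReal.mul_iSup]

lemma cubeSup_shift (h : ℝ≥0) (j k : Fin d → ℤ) (f : CadlagPath d) :
    cubeSup h k (shift (latticePoint h j) f) = cubeSup h (k + j) f := by
  simp only [cubeSup, shift_apply, latticePoint_add]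
  exact iSup_congr fun q => by rw [add_right_comm]

/-- Rational approximations from above eventually remain in the same half-open cube, so right
continuity bounds the value by the countable supremum. -/
lemma le_cubeSup {h : ℝ≥0} (hh : 0 < h) (f : CadlagPath d) (t : Fin d → ℝ) :
    (f.1 t : ℝ≥0∞) ≤ cubeSup h (cubeIndex h t) f := by
  have hh' : (0 : ℝ) < h := by exact_mod_cast hh
  set v : Fin d → ℝ := fun i => t i / h with hv
  have hlim := tendsto_gridCeil v
  have hvt : (h : ℝ) • v = t := by
    ext i; simp [hv, mul_div_cancel₀ _ hh'.ne']
  have hmul : Tendsto (fun n => (h : ℝ) • gridCeil n v) atTop (𝓝[Ici t] t) := by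
    refine tendsto_nhdsWithin_iff.2 ⟨?_, Eventually.of_forall fun n => ?_⟩
    · have := (tendsto_nhdsWithin_iff.1 hlim).1.const_smul (h : ℝ)
      rwa [hvt] at this
    · rw [mem_Ici, ← hvt]
      exact smul_le_smul_of_nonneg_left (le_gridCeil n v) hh'.le
  have hf : Tendsto (fun n => (f.1 ((h : ℝ) • gridCeil n v) : ℝ≥0∞)) atTop (𝓝 (f.1 t)) :=
    ENNReal.tendsto_coe.2 (((f.2 t).2.tendsto).comp hmul)
  have hev : ∀ᶠ n in atTop, ∀ i, gridCeil n v i < ⌊v i⌋ + 1 := by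
    rw [eventually_all]
    intro i
    exact ((tendsto_pi_nhds.1 (tendsto_nhdsWithin_iff.1 hlim).1) i).eventually
      (gt_mem_nhds (Int.lt_floor_add_one _))
  refine le_of_tendsto hf ?_
  filter_upwards [hev] with n hn
  have hq : ∀ i, ((((⌈((n : ℝ) + 1) * v i⌉ : ℤ) / ((n : ℚ) + 1) - ⌊v i⌋ : ℚ)) : ℝ)
      = gridCeil n v i - ⌊v i⌋ := fun i => by simp [gridCeil]
  refine le_iSup_of_le ⟨fun i => (⌈((n : ℝ) + 1) * v i⌉ : ℤ) / ((n : ℚ) + 1) - ⌊v i⌋, fun i => ⟨?_, ?_⟩⟩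
    (le_of_eq ?_)
  · rw [← Rat.cast_nonneg (K := ℝ), hq, sub_nonneg]
    exact (Int.floor_le _).trans (le_gridCeil n v i)
  · have : ((((⌈((n : ℝ) + 1) * v i⌉ : ℤ) / ((n : ℚ) + 1) - ⌊v i⌋ : ℚ)) : ℝ) < 1 := by
      rw [hq]; linarith [hn i]
    exact_mod_cast this
  · refine congrArg (fun u => (f.1 u : ℝ≥0∞)) (funext fun i => ?_)
    simp only [Pi.add_apply, latticePoint, cubeIndex, hq, Pi.smul_apply, smul_eq_mul]
    rw [show ⌊t i / (h : ℝ)⌋ = ⌊v i⌋ from rfl]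
    ring

/-- The cube with index `j` is the first one, in the lexicographic order, in which the path is
maximal among the cubes with indices in `J`. -/
def firstMax (h : ℝ≥0) (J : Set (Fin d → ℤ)) (j : Fin d → ℤ) : Set (CadlagPath d) :=
  {f | ∀ k ∈ J, cubeSup h k f < cubeSup h j f ∨ cubeSup h k f = cubeSup h j f ∧ toLex j ≤ toLex k}

lemma measurableSet_firstMax (h : ℝ≥0) (J : Set (Fin d → ℤ)) (j : Fin d → ℤ) :
    MeasurableSet (firstMax h J j) := by
  have : firstMax h J j = ⋂ k ∈ J, ({f | cubeSup h k f < cubeSup h j f} ∪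
      ({f | cubeSup h k f = cubeSup h j f} ∩ {_f | toLex j ≤ toLex k})) := by
    ext f; simp [firstMax]
  rw [this]
  exact MeasurableSet.biInter (to_countable J) fun k _ =>
    (measurableSet_lt (measurable_cubeSup h k) (measurable_cubeSup h j)).union
      ((measurableSet_eq_fun (measurable_cubeSup h k) (measurable_cubeSup h j)).inter
        (MeasurableSet.const _))

lemma scale_mem_firstMax {h : ℝ≥0} {J : Set (Fin d → ℤ)} {j : Fin d → ℤ} {c : ℝ≥0} (hc : 0 < c)
    {f : CadlagPath d} : scale c f ∈ firstMax h J j ↔ f ∈ firstMax h J j := by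
  have hc0 : (c : ℝ≥0∞) ≠ 0 := by exact_mod_cast hc.ne'
  simp only [firstMax, mem_ofPred_eq, cubeSup_scale, ENNReal.mul_lt_mul_iff_right hc0 ENNReal.coe_ne_top,
    ENNReal.mul_right_inj hc0 ENNReal.coe_ne_top]

/-- The lexicographic order on `ℤᵈ` is translation invariant, so the tie-breaking rule commutes with
lattice shifts. -/
lemma shift_mem_firstMax {h : ℝ≥0} {J : Set (Fin d → ℤ)} {i j : Fin d → ℤ} {f : CadlagPath d} :
    shift (latticePoint h i) f ∈ firstMax h {k | k + i ∈ J} j ↔ f ∈ firstMax h J (j + i) := by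
  simp only [firstMax, mem_ofPred_eq, cubeSup_shift]
  constructor
  · intro H k hk
    have := H (k - i) (by simpa using hk)
    simp only [sub_add_cancel] at this
    refine this.imp_right fun h2 => ⟨h2.1, ?_⟩
    have h3 := add_le_add_left h2.2 (toLex i)
    rwa [← toLex_add, ← toLex_add, sub_add_cancel] at h3
  · intro H k hk
    refine (H (k + i) hk).imp_right fun h2 => ⟨h2.1, ?_⟩
    have h3 := h2.2
    rw [toLex_add, toLex_add] at h3
    exact le_of_add_le_add_right h3

lemma firstMax_unique {h : ℝ≥0} {J : Set (Fin d → ℤ)} {i j : Fin d → ℤ} {f : CadlagPath d}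
    (hi : i ∈ J) (hj : j ∈ J) (hfi : f ∈ firstMax h J i) (hfj : f ∈ firstMax h J j) : i = j := by
  have h1 := hfi j hj
  have h2 := hfj i hi
  have h3 : cubeSup h i f = cubeSup h j f := by
    refine le_antisymm ?_ ?_
    · exact h2.elim (fun h => h.le) fun h => h.1.le
    · exact h1.elim (fun h => h.le) fun h => h.1.le
  have h4 := h1.resolve_left (by rw [h3]; exact lt_irrefl _)
  have h5 := h2.resolve_left (by rw [h3]; exact lt_irrefl _)
  exact toLex.injective (le_antisymm h4.2 h5.2)

lemma firstMax_anti (h : ℝ≥0) {J L : Set (Fin d → ℤ)} (hJL : J ⊆ L) (j : Fin d → ℤ) :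
    firstMax h L j ⊆ firstMax h J j := fun _ hf k hk => hf k (hJL hk)

end CadlagPath

/-! ### Asymptotics of the expected excess over large boxes -/

namespace CadlagPath

variable {d : ℕ}

/-- The set of paths is invariant under rescaling and under the translations of the lattice of
cubes of side `h`. -/
structure IsInvariantSet (h : ℝ≥0) (G : Set (CadlagPath d)) : Prop where
  measurableSet : MeasurableSet G
  scale_mem : ∀ (c : ℝ≥0) f, 0 < c → (scale c f ∈ G ↔ f ∈ G)
  shift_mem : ∀ k f, shift (latticePoint h k) f ∈ G ↔ f ∈ G

lemma isInvariantSet_univ (h : ℝ≥0) : IsInvariantSet h (univ : Set (CadlagPath d)) :=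
  ⟨MeasurableSet.univ, by simp, by simp⟩

lemma excess_cubes_le {h : ℝ≥0} (hh : 0 < h) (δ x : ℝ≥0) {J : Set (Fin d → ℤ)} {j : Fin d → ℤ}
    {f : CadlagPath d} (hf : f ∈ firstMax h J j) : excess δ (cubes h J) x f ≤ cubeSup h j f := by
  refine excess_le δ x f fun t ht => (le_cubeSup hh f t).trans ?_
  exact (hf _ ht).elim (fun h => h.le) fun h => h.1.le

lemma IsHomogeneous.indicator {G : Set (CadlagPath d)} {F : CadlagPath d → ℝ≥0∞}
    (hF : IsHomogeneous F) (hG : ∀ (c : ℝ≥0) f, 0 < c → (scale c f ∈ G ↔ f ∈ G)) :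
    IsHomogeneous (G.indicator F) := by
  intro c f hc
  by_cases h : f ∈ G
  · rw [indicator_of_mem h, indicator_of_mem ((hG c f hc).2 h), hF c f hc]
  · rw [indicator_of_notMem h, indicator_of_notMem (mt (hG c f hc).1 h), mul_zero]

/-- The expected excess on the event that the cube with index `j` is the first maximal one. -/
noncomputable def firstMaxExcess (μ : Measure (CadlagPath d)) (δ x : ℝ≥0) (G : Set (CadlagPath d))
    (J : Set (Fin d → ℤ)) (j : Fin d → ℤ) : ℝ≥0∞ :=
  ∫⁻ f, (G ∩ firstMax (cubeSide δ) J j).indicator (excess δ (cubes (cubeSide δ) J) x) f ∂μ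

/-- The integrand is homogeneous, because the events only compare suprema; shift invariance moves
cube `j` to the origin. -/
lemma firstMaxExcess_eq {μ : Measure (CadlagPath d)} (hμ : IsMaxInvariant μ) (δ x : ℝ≥0)
    {G : Set (CadlagPath d)} (hG : IsInvariantSet (cubeSide δ) G) (J : Set (Fin d → ℤ))
    (j : Fin d → ℤ) :
    firstMaxExcess μ δ x G J j = firstMaxExcess μ δ x G {k | k + j ∈ J} 0 := by
  refine Eq.trans ?_ (hμ.lintegral_shift
    ((measurable_excess δ (measurableSet_cubes _ _) x).indicator
      (hG.measurableSet.inter (measurableSet_firstMax _ _ _)))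
    ((isHomogeneous_excess δ _ x).indicator fun c f hc =>
      and_congr (hG.scale_mem c f hc) (scale_mem_firstMax hc)) (latticePoint (cubeSide δ) j))
  refine lintegral_congr fun f => ?_
  have hiff : shift (latticePoint (cubeSide δ) j) f ∈ G ∩ firstMax (cubeSide δ) {k | k + j ∈ J} 0 ↔
      f ∈ G ∩ firstMax (cubeSide δ) J j := by
    refine and_congr (hG.shift_mem j f) ?_
    rw [shift_mem_firstMax, zero_add]
  have hex : excess δ (cubes (cubeSide δ) {k | k + j ∈ J}) x (shift (latticePoint (cubeSide δ) j) f)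
      = excess δ (cubes (cubeSide δ) J) x f := by
    rw [← excess_shift (isLamShift_latticePoint δ j) (measurableSet_cubes _ J) x f]
    congr 1
    ext t
    simp only [cubes, mem_preimage, mem_ofPred_eq, cubeIndex_add_latticePoint (cubeSide_pos δ)]
  by_cases hf : f ∈ G ∩ firstMax (cubeSide δ) J j
  · rw [indicator_of_mem hf, indicator_of_mem (hiff.2 hf), hex]
  · rw [indicator_of_notMem hf, indicator_of_notMem (mt hiff.1 hf)]

lemma setLIntegral_excess_eq_sum {μ : Measure (CadlagPath d)} (δ x : ℝ≥0) {G : Set (CadlagPath d)}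
    (hG : MeasurableSet G) {J : Finset (Fin d → ℤ)} (hJ : J.Nonempty) :
    ∫⁻ f in G, excess δ (cubes (cubeSide δ) J) x f ∂μ
      = ∑ j ∈ J, firstMaxExcess μ δ x G J j := by
  classical
  simp only [firstMaxExcess]
  rw [← lintegral_finsetSum _ fun j _ => (measurable_excess δ (measurableSet_cubes _ _) x).indicator
    (hG.inter (measurableSet_firstMax _ _ _)), ← lintegral_indicator hG]
  refine lintegral_congr fun f => ?_
  by_cases hf : f ∈ G
  · obtain ⟨j, hj, hmax⟩ := exists_isMax_lex (fun k => cubeSup (cubeSide δ) k f) toLex J hJ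
    have hmem : f ∈ firstMax (cubeSide δ) J j := fun k hk => hmax k hk
    rw [indicator_of_mem hf, Finset.sum_eq_single_of_mem j hj, indicator_of_mem (mem_inter hf hmem)]
    exact fun k hk hkj => indicator_of_notMem (fun h => hkj (firstMax_unique hk hj h.2 hmem)) _
  · rw [indicator_of_notMem hf]
    exact (Finset.sum_eq_zero fun k _ => indicator_of_notMem (fun h => hf h.1) _).symm

lemma iUnion_latticeWindow (d : ℕ) : ⋃ m, latticeWindow d m = univ := by
  refine eq_univ_of_forall fun k => mem_iUnion.2 ⟨∑ i, (k i).natAbs, fun i => ?_⟩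
  have h1 : (k i).natAbs ≤ ∑ i, (k i).natAbs :=
    Finset.single_le_sum (f := fun i => (k i).natAbs) (fun _ _ => Nat.zero_le _) (Finset.mem_univ i)
  omega

lemma latticeWindow_mono (d : ℕ) : Monotone (latticeWindow d) := fun m n hmn k hk i => by
  have := hk i
  constructor <;> omega

lemma setLIntegral_excess_firstMax_le {μ : Measure (CadlagPath d)} (δ x : ℝ≥0)
    (G : Set (CadlagPath d)) :
    ∫⁻ f in G ∩ firstMax (cubeSide δ) univ 0, excess δ univ x f ∂μ ≤
      ∫⁻ f, cubeSup (cubeSide δ) 0 f ∂μ := by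
  refine (lintegral_mono_set inter_subset_right).trans ?_
  refine (setLIntegral_mono (measurable_cubeSup _ _) fun f hf => ?_).trans
    (setLIntegral_le_lintegral _ _)
  have := excess_cubes_le (cubeSide_pos δ) δ x hf
  rwa [cubes, preimage_univ] at this

/-- The expected excess over a large box, per unit of volume, converges. -/
lemma tendsto_setLIntegral_excess_box {μ : Measure (CadlagPath d)} (hμ : IsMaxInvariant μ)
    (δ x : ℝ≥0) (hsup : ∫⁻ f, cubeSup (cubeSide δ) 0 f ∂μ ≠ ∞) {G : Set (CadlagPath d)}
    (hG : IsInvariantSet (cubeSide δ) G) :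
    Tendsto (fun n : ℕ => (∫⁻ f in G, excess δ (cubes (cubeSide δ) (latticeBox d n)) x f ∂μ)
      / (n : ℝ≥0∞) ^ d) atTop (𝓝 (∫⁻ f in G ∩ firstMax (cubeSide δ) univ 0, excess δ univ x f ∂μ)) := by
  set h := cubeSide δ with hh
  have hpos : 0 < h := cubeSide_pos δ
  have hwin0 : ∀ m, (0 : Fin d → ℤ) ∈ latticeWindow d m := fun m i => by simp
  have hGm : ∀ J, MeasurableSet (G ∩ firstMax h J 0) := fun J =>
    hG.measurableSet.inter (measurableSet_firstMax _ _ _)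
  have hcubes : Monotone fun m => cubes h (latticeWindow d m) := fun m n hmn =>
    preimage_mono (latticeWindow_mono d hmn)
  have hcubesU : ⋃ m, cubes h (latticeWindow d m) = univ := by
    rw [← preimage_univ (f := cubeIndex h), ← iUnion_latticeWindow d, preimage_iUnion]
    rfl
  have hexU : ∀ f : CadlagPath d, excess δ univ x f = ⨆ m, excess δ (cubes h (latticeWindow d m)) x f :=
    fun f => by rw [← excess_iUnion δ hcubes, hcubesU]
  have hexle : ∀ (J) (f : CadlagPath d), excess δ (cubes h J) x f ≤ excess δ univ x f :=
    fun J f => excess_mono δ (subset_univ _) x f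
  -- The lower bound shrinks the region of the excess and enlarges the competition for the maximum;
  -- the upper bound does the reverse. Off the limiting event the excess over all of space may be
  -- infinite, so the upper bound caps it by `cubeSup h 0`, which also dominates.
  have key := tendsto_average_latticeBox (d := d) (φ := fun J => firstMaxExcess μ δ x G J 0)
    (l := fun m => ∫⁻ f, (G ∩ firstMax h univ 0).indicator
      (excess δ (cubes h (latticeWindow d m)) x) f ∂μ)
    (u := fun m => ∫⁻ f, (G ∩ firstMax h (latticeWindow d m) 0).indicator
      (fun f => min (excess δ univ x f) (cubeSup h 0 f)) f ∂μ)
    (β := ∫⁻ f in G ∩ firstMax h univ 0, excess δ univ x f ∂μ) hsup ?_ ?_ ?_ ?_ ?_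
  · refine key.congr' ?_
    filter_upwards [eventually_gt_atTop 0] with n hn
    have hne : (latticeBox d n).Nonempty := ⟨0, mem_latticeBox.2 fun i => by simpa using hn⟩
    rw [setLIntegral_excess_eq_sum δ x hG.measurableSet hne]
    congr 1
    exact Finset.sum_congr rfl fun j _ => (firstMaxExcess_eq hμ δ x hG _ j).symm
  · intro J _
    refine lintegral_mono fun f => ?_
    by_cases hf : f ∈ G ∩ firstMax h J 0
    · rw [indicator_of_mem hf]
      exact excess_cubes_le hpos δ x hf.2
    · rw [indicator_of_notMem hf]
      exact zero_le
  · intro m J hJ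
    refine lintegral_mono fun f => ?_
    refine (indicator_le_indicator (excess_mono δ (preimage_mono hJ) x f)).trans ?_
    exact indicator_le_indicator_of_subset
      (inter_subset_inter_right _ (firstMax_anti h (subset_univ J) 0)) (fun _ => zero_le) f
  · intro m J hJ
    refine lintegral_mono fun f => ?_
    by_cases hf : f ∈ G ∩ firstMax h J 0
    · rw [indicator_of_mem hf, indicator_of_mem (mem_inter hf.1 (firstMax_anti h hJ 0 hf.2))]
      exact le_min (hexle J f) (excess_cubes_le hpos δ x hf.2)
    · rw [indicator_of_notMem hf]
      exact zero_le
  · rw [← lintegral_indicator (hGm univ)]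
    refine lintegral_tendsto_of_tendsto_of_monotone (fun m => ((measurable_excess δ
      (measurableSet_cubes _ _) x).indicator (hGm univ)).aemeasurable)
      (Eventually.of_forall fun f m n hmn => indicator_le_indicator
        (excess_mono δ (hcubes hmn) x f)) (Eventually.of_forall fun f => ?_)
    by_cases hf : f ∈ G ∩ firstMax h univ 0
    · simp only [indicator_of_mem hf]
      rw [hexU]
      exact tendsto_atTop_iSup fun m n hmn => excess_mono δ (hcubes hmn) x f
    · simp only [indicator_of_notMem hf]
      exact tendsto_const_nhds
  · rw [← lintegral_indicator (hGm univ)]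
    refine tendsto_lintegral_of_dominated_convergence (cubeSup h 0) (fun m => ((measurable_excess δ
      MeasurableSet.univ x).min (measurable_cubeSup h 0)).indicator (hGm _))
      (fun m => Eventually.of_forall fun f => ?_) hsup (Eventually.of_forall fun f => ?_)
    · refine indicator_le' (fun f _ => min_le_right _ _) (fun f _ => zero_le) f
    · by_cases hf : f ∈ G ∩ firstMax h univ 0
      · have h1 : excess δ univ x f ≤ cubeSup h 0 f := by
          have := excess_cubes_le hpos δ x hf.2
          rwa [cubes, preimage_univ] at this
        refine tendsto_const_nhds.congr fun m => ?_
        rw [indicator_of_mem hf, indicator_of_mem (mem_inter hf.1 (firstMax_anti h (subset_univ _) 0 hf.2)),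
          min_eq_left h1]
      · rw [indicator_of_notMem hf]
        refine tendsto_const_nhds.congr' ?_
        by_cases hfG : f ∈ G
        · have h1 : ∃ k, ¬ (cubeSup h k f < cubeSup h 0 f ∨
              cubeSup h k f = cubeSup h 0 f ∧ toLex 0 ≤ toLex k) := by
            by_contra hcon
            exact hf ⟨hfG, fun k _ => not_not.1 (not_exists.1 hcon k)⟩
          obtain ⟨k, hk⟩ := h1
          obtain ⟨m, hm⟩ := mem_iUnion.1 ((iUnion_latticeWindow d).symm ▸ mem_univ k)
          filter_upwards [eventually_ge_atTop m] with n hn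
          exact (indicator_of_notMem (fun hmem => hk (hmem.2 k (latticeWindow_mono d hn hm))) _).symm
        · exact Eventually.of_forall fun m => (indicator_of_notMem (fun hmem => hfG hmem.1) _).symm

/-- The expected excess over `[0, T]ᵈ`, per unit of volume, converges. -/
theorem tendsto_setLIntegral_excess_Icc {μ : Measure (CadlagPath d)} (hμ : IsMaxInvariant μ)
    (δ x : ℝ≥0) (hsup : ∫⁻ f, cubeSup (cubeSide δ) 0 f ∂μ ≠ ∞) {G : Set (CadlagPath d)}
    (hG : IsInvariantSet (cubeSide δ) G) :
    Tendsto (fun T : ℝ => (∫⁻ f in G, excess δ (Icc 0 fun _ => T) x f ∂μ) / ENNReal.ofReal (T ^ d))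
      atTop (𝓝 ((∫⁻ f in G ∩ firstMax (cubeSide δ) univ 0, excess δ univ x f ∂μ)
        / (cubeSide δ : ℝ≥0∞) ^ d)) := by
  have hbox := tendsto_setLIntegral_excess_box hμ δ x hsup hG
  have hβ := ne_top_of_le_ne_top hsup (setLIntegral_excess_firstMax_le (μ := μ) δ x G)
  set β := ∫⁻ f in G ∩ firstMax (cubeSide δ) univ 0, excess δ univ x f ∂μ with hβdef
  set h := cubeSide δ with hh
  have hpos : 0 < h := cubeSide_pos δ
  have hpos' : (0 : ℝ) < h := by exact_mod_cast hpos
  set b : ℕ → ℝ≥0∞ := fun n => ∫⁻ f in G, excess δ (cubes h (latticeBox d n)) x f ∂μ with hb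
  have hfloor : Tendsto (fun T : ℝ => ⌊(h : ℝ)⁻¹ * T⌋₊) atTop atTop :=
    tendsto_nat_floor_atTop.comp (tendsto_id.const_mul_atTop (inv_pos.2 hpos'))
  have hr : Tendsto (fun T : ℝ => (⌊(h : ℝ)⁻¹ * T⌋₊ : ℝ) / T) atTop (𝓝 (h : ℝ)⁻¹) :=
    tendsto_nat_floor_mul_div_atTop (inv_pos.2 hpos').le
  have hr' : Tendsto (fun T : ℝ => ((⌊(h : ℝ)⁻¹ * T⌋₊ + 1 : ℕ) : ℝ) / T) atTop (𝓝 (h : ℝ)⁻¹) := by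
    have := hr.add tendsto_inv_atTop_zero
    rw [add_zero] at this
    refine this.congr fun T => ?_
    push_cast
    rw [add_div, one_div]
  have hlim : ∀ N : ℝ → ℕ, Tendsto N atTop atTop →
      Tendsto (fun T : ℝ => (N T : ℝ) / T) atTop (𝓝 (h : ℝ)⁻¹) →
      Tendsto (fun T : ℝ => b (N T) / ENNReal.ofReal (T ^ d)) atTop (𝓝 (β / (h : ℝ≥0∞) ^ d)) := by
    intro N hN hNr
    have h1 := ENNReal.tendsto_ofReal (hNr.pow d)
    have h2 : ENNReal.ofReal ((h : ℝ)⁻¹ ^ d) = ((h : ℝ≥0∞) ^ d)⁻¹ := by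
      rw [ENNReal.ofReal_pow (by positivity), ENNReal.ofReal_inv_of_pos hpos',
        ENNReal.ofReal_coe_nnreal, ENNReal.inv_pow]
    rw [h2] at h1
    have h3 := ENNReal.Tendsto.mul (hbox.comp hN) (Or.inr (by simp [hpos.ne'])) h1 (Or.inr hβ)
    rw [div_eq_mul_inv]
    refine h3.congr' ?_
    filter_upwards [eventually_gt_atTop 0, hN.eventually (eventually_gt_atTop 0)] with T hT hNT
    have hn0 : (N T : ℝ≥0∞) ^ d ≠ 0 := pow_ne_zero _ (by exact_mod_cast hNT.ne')
    have hnt : (N T : ℝ≥0∞) ^ d ≠ ∞ := ENNReal.pow_ne_top (by simp)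
    change b (N T) / (N T : ℝ≥0∞) ^ d * _ = _
    rw [div_pow, ENNReal.ofReal_div_of_pos (by positivity), ENNReal.ofReal_pow (by positivity),
      ENNReal.ofReal_natCast, ← mul_div_assoc, ENNReal.div_mul_cancel hn0 hnt]
  -- The box `[0, T]ᵈ` lies between the boxes of `⌊T / h⌋` and `⌊T / h⌋ + 1` cubes per side; the
  -- extra cube covers the remainder and the closed upper face.
  refine tendsto_of_tendsto_of_tendsto_of_le_of_le' (hlim _ hfloor hr)
    (hlim _ ((tendsto_add_atTop_nat 1).comp hfloor) hr') ?_ ?_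
  · filter_upwards [eventually_gt_atTop 0] with T hT
    refine ENNReal.div_le_div_right (lintegral_mono fun f => excess_mono δ (fun t ht => ?_) x f) _
    have ht' := mem_latticeBox.1 ht
    have h1 : ∀ i, 0 ≤ t i ∧ t i ≤ T := fun i => by
      have h2 := ht' i
      simp only [cubeIndex, Int.floor_nonneg, Int.floor_lt] at h2
      refine ⟨by rw [← div_mul_cancel₀ (t i) hpos'.ne']; exact mul_nonneg (by simpa using h2.1) hpos'.le, ?_⟩
      have h3 : t i / h < (h : ℝ)⁻¹ * T :=
        h2.2.trans_le (by exact_mod_cast Nat.floor_le (by positivity))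
      rw [div_eq_inv_mul] at h3
      exact (lt_of_mul_lt_mul_left h3 (by positivity)).le
    exact ⟨fun i => (h1 i).1, fun i => (h1 i).2⟩
  · filter_upwards [eventually_gt_atTop 0] with T hT
    refine ENNReal.div_le_div_right (lintegral_mono fun f => excess_mono δ (fun t ht => ?_) x f) _
    refine mem_latticeBox.2 fun i => ?_
    have h1 : 0 ≤ t i := ht.1 i
    have h2 : t i ≤ T := ht.2 i
    simp only [cubeIndex, Int.floor_nonneg, Int.floor_lt]
    refine ⟨by positivity, ?_⟩
    have h3 : t i / h ≤ (h : ℝ)⁻¹ * T := by rw [div_eq_inv_mul]; gcongr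
    refine h3.trans_lt ?_
    have := Nat.lt_floor_add_one ((h : ℝ)⁻¹ * T)
    exact_mod_cast this

end CadlagPath

/-! ### Mass transport -/

namespace CadlagPath

variable {d : ℕ}

lemma indicator_eq_indicator_of_iff {α β : Type*} {A : Set α} {B : Set β} {F : α → ℝ≥0∞}
    {G : β → ℝ≥0∞} {a : α} {b : β} (h : a ∈ A ↔ b ∈ B) (hFG : F a = G b) :
    A.indicator F a = B.indicator G b := by
  by_cases ha : a ∈ A
  · rw [indicator_of_mem ha, indicator_of_mem (h.1 ha), hFG]
  · rw [indicator_of_notMem ha, indicator_of_notMem (mt h.2 ha)]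

/-- The mass transport principle for the lattice of cubes. -/
lemma mass_transport {μ : Measure (CadlagPath d)} (hμ : IsMaxInvariant μ) (h : ℝ≥0)
    {a b : CadlagPath d → ℝ≥0∞} (ha : Measurable a) (hb : Measurable b) (hha : IsHomogeneous a)
    (hhb : ∀ (c : ℝ≥0) f, 0 < c → b (scale c f) = b f) :
    ∫⁻ f, (∑' j, a (shift (latticePoint h j) f)) * b f ∂μ
      = ∫⁻ f, a f * ∑' j, b (shift (latticePoint h j) f) ∂μ := by
  simp_rw [← ENNReal.tsum_mul_right, ← ENNReal.tsum_mul_left]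
  have h1 : ∀ j, AEMeasurable (fun f => a (shift (latticePoint h j) f) * b f) μ := fun j =>
    ((ha.comp (measurable_shift _)).mul hb).aemeasurable
  have h2 : ∀ j, AEMeasurable (fun f => a f * b (shift (latticePoint h j) f)) μ := fun j =>
    (ha.mul (hb.comp (measurable_shift _))).aemeasurable
  rw [lintegral_tsum h1, lintegral_tsum h2, ← (Equiv.neg (Fin d → ℤ)).tsum_eq]
  refine tsum_congr fun j => ?_
  have hG : Measurable fun f => a f * b (shift (latticePoint h j) f) :=
    ha.mul (hb.comp (measurable_shift _))
  rw [← hμ.lintegral_shift hG (fun c f hc => by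
    rw [hha c f hc, shift_scale, hhb c _ hc, mul_assoc]) (latticePoint h (-j))]
  refine lintegral_congr fun f => ?_
  rw [shift_shift, ← latticePoint_add, add_neg_cancel, latticePoint_zero, shift_zero]
  rfl

lemma cubeSup_eq_shift (h : ℝ≥0) (k : Fin d → ℤ) (f : CadlagPath d) :
    cubeSup h k f = cubeSup h 0 (shift (latticePoint h k) f) := by
  rw [cubeSup_shift, zero_add]

lemma shift_mem_firstMax_univ {h : ℝ≥0} {j : Fin d → ℤ} {f : CadlagPath d} :
    shift (latticePoint h j) f ∈ firstMax h univ 0 ↔ f ∈ firstMax h univ j := by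
  simpa using shift_mem_firstMax (h := h) (J := univ) (i := j) (j := 0) (f := f)

lemma tsum_indicator_firstMax_le (h : ℝ≥0) (g : CadlagPath d → ℝ≥0∞) (f : CadlagPath d) :
    ∑' j, (firstMax h univ j).indicator g f ≤ g f := by
  by_cases hf : ∃ j, f ∈ firstMax h univ j
  · obtain ⟨j, hj⟩ := hf
    rw [tsum_eq_single j, indicator_of_mem hj]
    exact fun k hk => indicator_of_notMem
      (fun hk' => hk (firstMax_unique (mem_univ _) (mem_univ _) hk' hj)) _
  · push Not at hf
    simp [hf]

/-- Let each cube send its supremum to the first maximal cube. Cube `0` sends at most `cubeSup h 0`,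
of finite mean, and when it is the maximal cube it receives the whole sum. -/
lemma ae_tsum_cubeSup_ne_top_of_firstMax {μ : Measure (CadlagPath d)} (hμ : IsMaxInvariant μ)
    {h : ℝ≥0} (hsup : ∫⁻ f, cubeSup h 0 f ∂μ ≠ ∞) :
    ∀ᵐ f ∂μ, f ∈ firstMax h univ 0 → ∑' k, cubeSup h k f ≠ ∞ := by
  have hb : Measurable ((firstMax h univ 0).indicator (1 : CadlagPath d → ℝ≥0∞)) :=
    measurable_one.indicator (measurableSet_firstMax _ _ _)
  have key := mass_transport hμ h (measurable_cubeSup h 0) hb (fun c f _ => cubeSup_scale h 0 c f)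
    (fun c f hc => indicator_eq_indicator_of_iff (scale_mem_firstMax hc) rfl)
  simp only [← cubeSup_eq_shift] at key
  have hle : ∫⁻ f, (∑' k, cubeSup h k f) * (firstMax h univ 0).indicator 1 f ∂μ ≠ ∞ := by
    rw [key]
    refine ne_top_of_le_ne_top hsup (lintegral_mono fun f => ?_)
    refine mul_le_of_le_one_right' (le_trans (le_of_eq (tsum_congr fun j => ?_))
      (tsum_indicator_firstMax_le h 1 f))
    exact indicator_eq_indicator_of_iff shift_mem_firstMax_univ rfl
  filter_upwards [ae_lt_top ((Measurable.tsum fun k => measurable_cubeSup h k).mul hb) hle]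
    with f hf hmem
  rw [Pi.mul_apply, indicator_of_mem hmem, Pi.one_apply, mul_one] at hf
  exact hf.ne

/-- The mass of the path on the cube with index `k`. -/
noncomputable def cubeMass (δ h : ℝ≥0) (k : Fin d → ℤ) (f : CadlagPath d) : ℝ≥0∞ :=
  ∫⁻ t in cubes h {k}, f.1 t ∂(lam d δ)

lemma measurable_cubeMass (δ h : ℝ≥0) (k : Fin d → ℤ) : Measurable (cubeMass (d := d) δ h k) :=
  Measurable.lintegral_prod_right' (f := fun p : CadlagPath d × (Fin d → ℝ) => (p.1.1 p.2 : ℝ≥0∞))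
    measurable_eval.coe_nnreal_ennreal

lemma isHomogeneous_cubeMass (δ h : ℝ≥0) (k : Fin d → ℤ) :
    IsHomogeneous (cubeMass (d := d) δ h k) := fun c f _ => by
  simp only [cubeMass, scale_apply, ENNReal.coe_mul]
  exact lintegral_const_mul' _ _ ENNReal.coe_ne_top

lemma cubeMass_shift {δ h : ℝ≥0} (hh : 0 < h) {j : Fin d → ℤ} (hj : IsLamShift d δ (latticePoint h j))
    (k : Fin d → ℤ) (f : CadlagPath d) :
    cubeMass δ h k (shift (latticePoint h j) f) = cubeMass δ h (k + j) f := by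
  have := hj.setLIntegral_comp_preimage (measurableSet_cubes h {k + j})
    (measurable_coe f).coe_nnreal_ennreal
  rw [cubeMass, cubeMass, ← this]
  congr 2
  ext t
  simp [cubes, cubeIndex_add_latticePoint hh]

lemma tsum_cubeMass (δ h : ℝ≥0) (f : CadlagPath d) : ∑' k, cubeMass δ h k f = totalMass δ f.1 := by
  simp only [cubeMass]
  rw [← lintegral_iUnion (fun k => measurableSet_cubes h {k})]
  · rw [totalMass]
    have : ⋃ k : Fin d → ℤ, cubes h {k} = univ := by ext t; simp [cubes]
    rw [this, Measure.restrict_univ]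
  · exact fun i j hij => (disjoint_singleton.2 hij).preimage _

lemma cubeMass_le {δ h : ℝ≥0} (hh : 0 < h) (f : CadlagPath d) :
    cubeMass δ h 0 f ≤ cubeSup h 0 f * lam d δ (cubes h {0}) := by
  rw [← setLIntegral_const]
  refine setLIntegral_mono measurable_const fun t ht => ?_
  have h0 : cubeIndex h t = 0 := ht
  simpa [h0] using le_cubeSup hh f t

/-- Summable cube suprema thus control `S_δ` for every admissible `δ`, including `δ = 0`. -/
lemma totalMass_le {δ h : ℝ≥0} (hh : 0 < h) (hδ : ∀ j, IsLamShift d δ (latticePoint h j))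
    (f : CadlagPath d) : totalMass δ f.1 ≤ (∑' k, cubeSup h k f) * lam d δ (cubes h {0}) := by
  rw [← tsum_cubeMass δ h f, ← ENNReal.tsum_mul_right]
  refine ENNReal.tsum_le_tsum fun k => ?_
  have := cubeMass_le (δ := δ) hh (shift (latticePoint h k) f)
  rwa [cubeMass_shift hh (hδ k), cubeSup_shift, zero_add] at this

lemma volume_cube_ne_top {h : ℝ≥0} (hh : 0 < h) : volume (cubes (d := d) h {0}) ≠ ∞ := by
  have hh' : (0 : ℝ) < h := by exact_mod_cast hh
  have hsub : cubes (d := d) h {0} ⊆ Icc 0 fun _ => (h : ℝ) := by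
    intro t ht
    have h0 : cubeIndex h t = 0 := ht
    have h1 : ∀ i, 0 ≤ t i ∧ t i ≤ h := fun i => by
      have h2 := congrFun h0 i
      simp only [cubeIndex, Pi.zero_apply, Int.floor_eq_zero_iff, mem_Ico, div_lt_one hh'] at h2
      exact ⟨by rw [← div_mul_cancel₀ (t i) hh'.ne']; exact mul_nonneg h2.1 hh'.le, h2.2.le⟩
    exact ⟨fun i => (h1 i).1, fun i => (h1 i).2⟩
  exact ne_top_of_le_ne_top isCompact_Icc.measure_lt_top.ne (measure_mono hsub)

lemma totalMass_zero_ne_top {h : ℝ≥0} (hh : 0 < h) {f : CadlagPath d}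
    (hf : ∑' k, cubeSup h k f ≠ ∞) : totalMass 0 f.1 ≠ ∞ := by
  refine ne_top_of_le_ne_top (ENNReal.mul_ne_top hf ?_) (totalMass_le hh (fun j => isLamShift_zero _) f)
  rw [lam_zero]
  exact volume_cube_ne_top hh

lemma div_homogeneous {F S : CadlagPath d → ℝ≥0∞} (hF : IsHomogeneous F) (hS : IsHomogeneous S)
    (c : ℝ≥0) (f : CadlagPath d) (hc : 0 < c) : F (scale c f) / S (scale c f) = F f / S f := by
  rw [hF c f hc, hS c f hc, ENNReal.mul_div_mul_left _ _ (by exact_mod_cast hc.ne') ENNReal.coe_ne_top]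

/-- Transport the suprema in proportion to the share of `S_0` carried by each cube. The shares sum
to at most one, so the amount received has finite mean; when `S_0` is finite, some cube `k` has a
positive share, which forces a finite sum. -/
lemma ae_tsum_cubeSup_ne_top_of_totalMass {μ : Measure (CadlagPath d)} (hμ : IsMaxInvariant μ)
    {h : ℝ≥0} (hh : 0 < h) (hsup : ∫⁻ f, cubeSup h 0 f ∂μ ≠ ∞) :
    ∀ᵐ f ∂μ, totalMass 0 f.1 ≠ ∞ → ∑' k, cubeSup h k f ≠ ∞ := by
  have hb : ∀ k, Measurable fun f : CadlagPath d => cubeMass 0 h k f / totalMass 0 f.1 := fun k =>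
    (measurable_cubeMass 0 h k).div (measurable_totalMass 0)
  have hk : ∀ k : Fin d → ℤ,
      ∀ᵐ f ∂μ, (∑' i, cubeSup h i f) * (cubeMass 0 h k f / totalMass 0 f.1) < ∞ := by
    intro k
    have key := mass_transport hμ h (measurable_cubeSup h 0) (hb k)
      (fun c f _ => cubeSup_scale h 0 c f)
      (div_homogeneous (isHomogeneous_cubeMass 0 h k) (isHomogeneous_totalMass 0))
    simp only [← cubeSup_eq_shift] at key
    refine ae_lt_top ((Measurable.tsum fun k => measurable_cubeSup h k).mul (hb k)) ?_
    rw [key]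
    refine ne_top_of_le_ne_top hsup (lintegral_mono fun f => mul_le_of_le_one_right' ?_)
    simp only [totalMass_shift (isLamShift_zero _), cubeMass_shift hh (isLamShift_zero _), div_eq_mul_inv]
    have hk := (Equiv.addLeft k).tsum_eq fun j => cubeMass 0 h j f
    simp only [Equiv.coe_addLeft] at hk
    rw [ENNReal.tsum_mul_right, hk, tsum_cubeMass]
    exact ENNReal.div_self_le_one
  filter_upwards [ae_all_iff.2 hk, hμ.nonzero] with f hf hne hS
  have hpos : ∑' k, cubeMass 0 h k f ≠ 0 := by
    rw [tsum_cubeMass]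
    exact (totalMass_zero_pos hne).ne'
  obtain ⟨k, hk⟩ : ∃ k, cubeMass 0 h k f ≠ 0 := by
    by_contra hcon
    push Not at hcon
    exact hpos (by simp [hcon])
  intro htop
  have := hf k
  rw [htop, ENNReal.top_mul (ENNReal.div_pos hk hS).ne'] at this
  exact lt_irrefl _ this

lemma exists_mem_firstMax {h : ℝ≥0} (hh : 0 < h) {f : CadlagPath d} (hf : ∃ t, 0 < f.1 t)
    (hsum : ∑' k, cubeSup h k f ≠ ∞) : ∃ j, f ∈ firstMax h univ j := by
  obtain ⟨t, ht⟩ := hf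
  have hpos : ∃ k, 0 < cubeSup h k f :=
    ⟨_, lt_of_lt_of_le (by exact_mod_cast ht) (le_cubeSup hh f t)⟩
  obtain ⟨j, hj⟩ := exists_isMax_lex_of_tsum_ne_top (fun k => cubeSup h k f) toLex hsum hpos
  exact ⟨j, fun k _ => hj k⟩

/-- The limit of the expected excess in terms of the normalised path. -/
theorem setLIntegral_excess_firstMax_eq {μ : Measure (CadlagPath d)} [SFinite μ]
    (hμ : IsMaxInvariant μ) (δ x : ℝ≥0)
    (hsum : ∀ᵐ f ∂μ, ∑' k, cubeSup (cubeSide δ) k f ≠ ∞) :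
    ∫⁻ f in firstMax (cubeSide δ) univ 0, excess δ univ x f ∂μ
      = (cubeSide δ : ℝ≥0∞) ^ d *
        ∫⁻ f, f.1 0 * (excess δ univ x f / totalMass δ f.1) ∂μ := by
  set h := cubeSide δ with hh
  have hpos : 0 < h := cubeSide_pos δ
  have hF : Measurable (excess (d := d) δ univ x) := measurable_excess δ MeasurableSet.univ x
  have hFS : Measurable fun f : CadlagPath d => excess δ univ x f / totalMass δ f.1 :=
    hF.div (measurable_totalMass δ)
  have hhom := div_homogeneous (isHomogeneous_excess (d := d) δ univ x) (isHomogeneous_totalMass δ)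
  have hinv : ∀ τ, IsLamShift d δ τ → ∀ f : CadlagPath d,
      excess δ univ x (shift τ f) / totalMass δ (shift τ f).1 = excess δ univ x f / totalMass δ f.1 := by
    intro τ hτ f
    rw [totalMass_shift hτ]
    have := excess_shift hτ MeasurableSet.univ x f
    rw [preimage_univ] at this
    rw [this]
  -- One side collects the cube masses into `S_δ`, which cancels the denominator; the other uses
  -- that exactly one lattice shift brings the first maximal cube to the origin.
  have key := mass_transport hμ h (measurable_cubeMass δ h 0)
    (hFS.indicator (measurableSet_firstMax h univ 0)) (isHomogeneous_cubeMass δ h 0)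
    (fun c f hc => indicator_eq_indicator_of_iff (scale_mem_firstMax hc) (hhom c f hc))
  have hfinite : ∀ f : CadlagPath d, ∑' k, cubeSup h k f ≠ ∞ → totalMass δ f.1 ≠ ∞ := fun f hf =>
    ne_top_of_le_ne_top (ENNReal.mul_ne_top hf (by rw [hh, lam_cube]; simp))
      (totalMass_le hpos (fun j => isLamShift_latticePoint δ j) f)
  have hleft : ∫⁻ f in firstMax h univ 0, excess δ univ x f ∂μ
      = ∫⁻ f, (∑' j, cubeMass δ h 0 (shift (latticePoint h j) f)) * (firstMax h univ 0).indicator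
        (fun f => excess δ univ x f / totalMass δ f.1) f ∂μ := by
    rw [← lintegral_indicator (measurableSet_firstMax h univ 0)]
    refine lintegral_congr_ae ?_
    filter_upwards [hsum] with f hf
    simp only [cubeMass_shift hpos (isLamShift_latticePoint δ _), zero_add, tsum_cubeMass]
    by_cases hmem : f ∈ firstMax h univ 0
    · rw [indicator_of_mem hmem, indicator_of_mem hmem]
      -- For `δ > 0` a nonzero path may vanish on the whole lattice; its excess is then zero as
      -- well.
      rcases eq_or_ne (totalMass δ f.1) 0 with h0 | h0
      · rw [h0, zero_mul, excess_eq_zero_of_totalMass δ x univ h0]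
      · rw [ENNReal.mul_div_cancel h0 (hfinite f hf)]
    · rw [indicator_of_notMem hmem, indicator_of_notMem hmem, mul_zero]
  have hright : ∫⁻ f, cubeMass δ h 0 f * ∑' j, (firstMax h univ 0).indicator
        (fun f => excess δ univ x f / totalMass δ f.1) (shift (latticePoint h j) f) ∂μ
      = ∫⁻ f, cubeMass δ h 0 f * (excess δ univ x f / totalMass δ f.1) ∂μ := by
    refine lintegral_congr_ae ?_
    filter_upwards [hsum, hμ.nonzero] with f hf hne
    obtain ⟨j, hj⟩ := exists_mem_firstMax hpos hne hf
    rw [tsum_eq_single j, indicator_of_mem (shift_mem_firstMax_univ.2 hj),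
      hinv _ (isLamShift_latticePoint δ j)]
    exact fun k hk => indicator_of_notMem (fun hk' => hk (firstMax_unique (mem_univ _) (mem_univ _)
      (shift_mem_firstMax_univ.1 hk') hj)) _
  rw [hleft, key, hright]
  simp only [cubeMass]
  have hG : Measurable fun f : CadlagPath d => f.1 0 * (excess δ univ x f / totalMass δ f.1) :=
    (measurable_apply 0).coe_nnreal_ennreal.mul hFS
  calc ∫⁻ f, (∫⁻ t in cubes h {0}, f.1 t ∂(lam d δ)) * (excess δ univ x f / totalMass δ f.1) ∂μ
      = ∫⁻ f, ∫⁻ t in cubes h {0}, f.1 t * (excess δ univ x f / totalMass δ f.1) ∂(lam d δ) ∂μ := by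
        refine lintegral_congr fun f => ?_
        rw [lintegral_mul_const _ (measurable_coe f).coe_nnreal_ennreal]
    _ = ∫⁻ t in cubes h {0}, ∫⁻ f, f.1 t * (excess δ univ x f / totalMass δ f.1) ∂μ ∂(lam d δ) := by
        refine lintegral_lintegral_swap (Measurable.aemeasurable ?_)
        exact measurable_eval.coe_nnreal_ennreal.mul (hFS.comp measurable_fst)
    -- The quotient is invariant under translations preserving `λ_δ`, so shift invariance replaces
    -- the value at `t` by the value at `0`.
    _ = ∫⁻ t in cubes h {0}, ∫⁻ f, f.1 0 * (excess δ univ x f / totalMass δ f.1) ∂μ ∂(lam d δ) := by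
        refine lintegral_congr_ae (ae_restrict_of_ae ?_)
        filter_upwards [ae_isLamShift d δ] with t ht
        rw [← hμ.lintegral_shift hG (fun c f hc => by
          rw [hhom c f hc, scale_apply, ENNReal.coe_mul, mul_assoc]) t]
        refine lintegral_congr fun f => ?_
        rw [hinv t ht, shift_apply, zero_add]
    _ = _ := by rw [setLIntegral_const, hh, lam_cube, mul_comm]

lemma isInvariantSet_totalMass (h : ℝ≥0) :
    IsInvariantSet h {f : CadlagPath d | totalMass 0 f.1 < ∞} := by
  refine ⟨measurableSet_lt (measurable_totalMass 0) measurable_const, fun c f hc => ?_, fun k f => ?_⟩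
  · have hc0 : (c : ℝ≥0∞) ≠ 0 := by exact_mod_cast hc.ne'
    have := isHomogeneous_totalMass 0 c f hc
    simp only [mem_ofPred_eq, lt_top_iff_ne_top] at this ⊢
    rw [this]
    refine ⟨fun h1 h2 => h1 (by rw [h2, ENNReal.mul_top hc0]), fun h1 => ENNReal.mul_ne_top (by simp) h1⟩
  · simp only [mem_ofPred_eq, totalMass_shift (isLamShift_zero _)]

/-- Paths with infinite mass do not contribute to the limit. -/
lemma setLIntegral_excess_firstMax_totalMass {μ : Measure (CadlagPath d)} (hμ : IsMaxInvariant μ)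
    (δ x : ℝ≥0) (hsup : ∫⁻ f, cubeSup (cubeSide δ) 0 f ∂μ ≠ ∞) :
    ∫⁻ f in {f | totalMass 0 f.1 < ∞} ∩ firstMax (cubeSide δ) univ 0, excess δ univ x f ∂μ
      = ∫⁻ f in univ ∩ firstMax (cubeSide δ) univ 0, excess δ univ x f ∂μ := by
  refine setLIntegral_congr ?_
  filter_upwards [ae_tsum_cubeSup_ne_top_of_firstMax hμ hsup] with f hf
  simp only [eq_iff_iff]
  exact ⟨fun hm => ⟨trivial, hm.2⟩,
    fun hm => ⟨(totalMass_zero_ne_top (cubeSide_pos δ) (hf hm.2)).lt_top, hm.2⟩⟩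

/-- If the mean at `0` on this event vanished, invariance would make it vanish at every point, hence
`S_0 = 0` there almost surely, contradicting that paths are nonzero. This makes the normalisation of
`V` legitimate. -/
lemma setLIntegral_totalMass_pos {μ : Measure (CadlagPath d)} [SFinite μ] (hμ : IsMaxInvariant μ)
    (hpos : μ {f | totalMass 0 f.1 < ∞} ≠ 0) :
    ∫⁻ f in {f | totalMass 0 f.1 < ∞}, f.1 0 ∂μ ≠ 0 := by
  intro h0
  set G : Set (CadlagPath d) := {f | totalMass 0 f.1 < ∞} with hGdef
  have hG := isInvariantSet_totalMass (d := d) 1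
  have h1 : ∀ t, ∫⁻ f in G, f.1 t ∂μ = 0 := by
    intro t
    rw [← h0, ← lintegral_indicator hG.measurableSet, ← lintegral_indicator hG.measurableSet,
      ← hμ.lintegral_shift ((measurable_apply 0).coe_nnreal_ennreal.indicator hG.measurableSet)
        (IsHomogeneous.indicator (fun c f _ => by simp) hG.scale_mem) t]
    refine lintegral_congr fun f => ?_
    simp [indicator, totalMass_shift (isLamShift_zero _)]
  have h2 : ∫⁻ f in G, totalMass 0 f.1 ∂μ = 0 := by
    simp only [totalMass]
    rw [lintegral_lintegral_swap (Measurable.aemeasurable measurable_eval.coe_nnreal_ennreal)]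
    simp [h1]
  rw [lintegral_eq_zero_iff (measurable_totalMass 0)] at h2
  have h3 : ∀ᵐ f ∂(μ.restrict G), False := by
    filter_upwards [h2, ae_restrict_of_ae hμ.nonzero] with f hf hne
    exact (totalMass_zero_pos hne).ne' hf
  rw [ae_iff] at h3
  simp at h3
  exact hpos h3

end CadlagPath

/-! ### Berman functions -/

namespace CadlagPath

variable {d : ℕ}

lemma isMaxInvariant_map {Ω Ω₁ : Type*} [MeasurableSpace Ω] [MeasurableSpace Ω₁]
    {P : Measure Ω} [IsProbabilityMeasure P] {P₁ : Measure Ω₁} [IsProbabilityMeasure P₁]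
    {Z : Ω → FieldPath d} (hZ : IsSpectralField P Z) {E : ℕ → Ω₁ → ℝ}
    {Zc : ℕ → Ω₁ → FieldPath d} (hX : IsDeHaanInput P Z P₁ E Zc)
    (hstat : IsStationaryField P₁ (deHaanField E Zc)) {Y : Ω → CadlagPath d} (hY : Measurable Y)
    (hYZ : ∀ᵐ ω ∂P, (Y ω).1 = Z ω) : IsMaxInvariant (P.map Y) where
  mean_one t := by
    rw [lintegral_map (measurable_apply t).coe_nnreal_ennreal hY, ← hZ.mean_one t]
    refine lintegral_congr_ae ?_
    filter_upwards [hYZ] with ω hω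
    rw [hω]
  nonzero := by
    have hset : {f : CadlagPath d | ∃ t, 0 < f.1 t}
        = ⋃ q : Fin d → ℚ, {f | 0 < f.1 (fun i => (q i : ℝ))} := by
      ext f
      simp only [mem_ofPred_eq, mem_iUnion]
      exact ⟨fun h => exists_rat_pos f h, fun ⟨q, hq⟩ => ⟨_, hq⟩⟩
    have hm : MeasurableSet {f : CadlagPath d | ∃ t, 0 < f.1 t} := by
      rw [hset]
      exact MeasurableSet.iUnion fun q => measurableSet_lt measurable_const (measurable_apply _)
    rw [ae_map_iff hY.aemeasurable hm]
    filter_upwards [hYZ, hZ.nonzero] with ω hω hne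
    rwa [hω]
  max_shift s τ := by
    have hm : Measurable fun f : CadlagPath d => (weightedMax s f.1 : ℝ≥0∞) :=
      ((measurable_weightedMax s).comp measurable_subtype_coe).coe_nnreal_ennreal
    rw [lintegral_map hm hY, lintegral_map (f := fun f => (weightedMax s (shift τ f).1 : ℝ≥0∞))
      (hm.comp (measurable_shift τ)) hY]
    have h1 := lintegral_weightedMax_shift hZ.measurable hX hstat s τ
    rw [lintegral_congr_ae (g := fun ω => (weightedMax s (fun t => Z ω (t + τ)) : ℝ≥0∞)), h1]
    · refine lintegral_congr_ae ?_
      filter_upwards [hYZ] with ω hω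
      rw [hω]
    · filter_upwards [hYZ] with ω hω
      simp only [shift, hω]

lemma lintegral_cubeSup_ne_top {Ω : Type*} [MeasurableSpace Ω] {P : Measure Ω}
    {Z : Ω → FieldPath d} (hZ : IsSpectralField P Z) {Y : Ω → CadlagPath d} (hY : Measurable Y)
    (hYZ : ∀ᵐ ω ∂P, (Y ω).1 = Z ω) {h : ℝ≥0} (hh : 0 < h) :
    ∫⁻ f, cubeSup h 0 f ∂(P.map Y) ≠ ∞ := by
  rw [lintegral_map (measurable_cubeSup h 0) hY]
  refine ne_top_of_le_ne_top (hZ.sup_integrable h (by exact_mod_cast hh)).ne (lintegral_mono_ae ?_)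
  filter_upwards [hYZ] with ω hω
  refine iSup_le fun q => ?_
  rw [latticePoint_zero, zero_add, hω]
  refine le_iSup₂ (f := fun (t : Fin d → ℝ) (_ : t ∈ Icc 0 fun _ => (h : ℝ)) => (Z ω t : ℝ≥0∞)) _ ?_
  have hq : ∀ i, (0 : ℝ) ≤ (q.1 i : ℝ) ∧ (q.1 i : ℝ) ≤ 1 := fun i =>
    ⟨by exact_mod_cast (q.2 i).1, by exact_mod_cast (q.2 i).2.le⟩
  exact ⟨fun i => mul_nonneg h.2 (hq i).1, fun i => mul_le_of_le_one_right h.2 (hq i).2⟩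

lemma map_eq_tiltedLaw {Ω Ω₂ : Type*} [MeasurableSpace Ω] [MeasurableSpace Ω₂] {P : Measure Ω}
    {P₂ : Measure Ω₂} {Z : Ω → FieldPath d} {Θ : Ω₂ → FieldPath d} (hZ : Measurable Z)
    (hΘ : IsTiltedField P Z P₂ Θ)
    {Y : Ω → CadlagPath d} (hY : Measurable Y) (hYZ : ∀ᵐ ω ∂P, (Y ω).1 = Z ω)
    {Y₂ : Ω₂ → CadlagPath d} (hY₂ : Measurable Y₂) (hYΘ : ∀ᵐ ω ∂P₂, (Y₂ ω).1 = Θ ω) :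
    P₂.map Y₂ = tiltedLaw (P.map Y) 0 0 := by
  refine Measure.ext fun A hA => ?_
  obtain ⟨B, hB, rfl⟩ := hA
  have hmB : MeasurableSet (Subtype.val ⁻¹' B : Set (CadlagPath d)) := measurable_subtype_coe hB
  have hdiv : Measurable fun f : FieldPath d => fun t => f t / f 0 :=
    measurable_pi_lambda _ fun t => (measurable_pi_apply t).div (measurable_pi_apply 0)
  have h1 : P₂ (Y₂ ⁻¹' (Subtype.val ⁻¹' B)) = P₂ {ω | Θ ω ∈ B} := by
    refine measure_congr ?_
    filter_upwards [hYΘ] with ω hω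
    simp only [eq_iff_iff]
    change (Y₂ ω).1 ∈ B ↔ Θ ω ∈ B
    rw [hω]
  have hm2 : Measurable fun f : CadlagPath d => (f.1 (0 + 0) : ℝ≥0∞) *
      (Subtype.val ⁻¹' B : Set (CadlagPath d)).indicator 1 (scale (f.1 (0 + 0))⁻¹ (shift 0 f)) :=
    (measurable_apply _).coe_nnreal_ennreal.mul
      ((measurable_one.indicator hmB).comp (measurable_normalize 0 0))
  have hmZ : MeasurableSet {ω | (fun t => Z ω t / Z ω 0) ∈ B} := (hdiv.comp hZ) hB
  rw [Measure.map_apply hY₂ hmB, h1, hΘ.law B hB, ← lintegral_indicator_one hmB,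
    lintegral_tiltedLaw _ _ _ (measurable_one.indicator hmB), lintegral_map hm2 hY,
    ← lintegral_indicator hmZ]
  refine lintegral_congr_ae ?_
  filter_upwards [hYZ] with ω hω
  have hiff : scale ((Y ω).1 (0 + 0))⁻¹ (shift 0 (Y ω)) ∈ (Subtype.val ⁻¹' B : Set (CadlagPath d)) ↔
      ω ∈ {ω | (fun t => Z ω t / Z ω 0) ∈ B} := by
    simp only [mem_preimage, mem_ofPred_eq, scale, shift_zero, add_zero, hω, div_eq_inv_mul]
  by_cases hmem : ω ∈ {ω | (fun t => Z ω t / Z ω 0) ∈ B}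
  · rw [indicator_of_mem hmem, indicator_of_mem (hiff.2 hmem), add_zero, hω, Pi.one_apply, mul_one]
  · rw [indicator_of_notMem hmem, indicator_of_notMem (mt hiff.1 hmem), mul_zero]

lemma excess_normalize (δ x : ℝ≥0) {f : CadlagPath d} (hf : totalMass δ f.1 ≠ ∞) :
    excess δ univ x (scale (totalMass δ f.1).toNNReal⁻¹ f) = excess δ univ x f / totalMass δ f.1 := by
  rcases eq_or_ne (totalMass δ f.1) 0 with h0 | h0
  · rw [h0, excess_eq_zero_of_totalMass δ x univ h0, ENNReal.zero_div]
    refine excess_eq_zero_of_totalMass δ x univ ?_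
    simp [totalMass]
  · have hpos : 0 < (totalMass δ f.1).toNNReal := ENNReal.toNNReal_pos h0 hf
    rw [isHomogeneous_excess δ univ x _ f (inv_pos.2 hpos), ENNReal.coe_inv hpos.ne',
      ENNReal.coe_toNNReal hf, ENNReal.div_eq_inv_mul]

lemma bermanRatio_eq {Ω : Type*} [MeasurableSpace Ω] {P : Measure Ω} [SFinite P]
    {W : Ω → FieldPath d} {Y : Ω → CadlagPath d} (hY : Measurable Y) (hYW : ∀ᵐ ω ∂P, (Y ω).1 = W ω)
    (δ x : ℝ≥0) (T : ℝ) : bermanRatio P W δ x T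
      = (∫⁻ f, excess δ (Icc 0 fun _ => T) x f ∂(P.map Y)) / ENNReal.ofReal (T ^ d) := by
  rw [bermanRatio, bermanOn_eq_lintegral_excess hY hYW δ x measurableSet_Icc,
    lintegral_map (measurable_excess δ measurableSet_Icc x) hY]

/-- The excess of the normalised tilted field, when the spectral field has finite total mass. -/
lemma bermanOn_normalizedField {Ω₂ : Type*} [MeasurableSpace Ω₂] {P₂ : Measure Ω₂} [SFinite P₂]
    {Θ : Ω₂ → FieldPath d} {Y₂ : Ω₂ → CadlagPath d} (hY₂ : Measurable Y₂)
    (hYΘ : ∀ᵐ ω ∂P₂, (Y₂ ω).1 = Θ ω) {μ : Measure (CadlagPath d)}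
    (hlaw : P₂.map Y₂ = tiltedLaw μ 0 0) (δ x : ℝ≥0) (hS : ∀ᵐ f ∂μ, totalMass δ f.1 ≠ ∞) :
    bermanOn P₂ (normalizedField δ Θ) δ univ x
      = ∫⁻ f, f.1 0 * (excess δ univ x f / totalMass δ f.1) ∂μ := by
  have hn : Measurable fun f : CadlagPath d => scale (totalMass δ f.1).toNNReal⁻¹ f :=
    measurable_scale_uncurry.comp ((measurable_totalMass δ).ennreal_toNNReal.inv.prodMk measurable_id)
  have hex := measurable_excess (d := d) δ MeasurableSet.univ x
  rw [bermanOn_eq_lintegral_excess (hn.comp hY₂) _ δ x MeasurableSet.univ]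
  · have h1 := lintegral_map (μ := P₂) (hex.comp hn) hY₂
    refine Eq.trans h1.symm ?_
    rw [hlaw, lintegral_tiltedLaw _ _ _ (hex.comp hn)]
    refine lintegral_congr_ae ?_
    filter_upwards [hS] with f hf
    simp only [add_zero, shift_zero, Function.comp_apply]
    rcases eq_or_ne (f.1 0) 0 with h0 | h0
    · simp [h0]
    · have hc : 0 < (f.1 0)⁻¹ := inv_pos.2 (pos_iff_ne_zero.2 h0)
      have hfin : totalMass δ (scale (f.1 0)⁻¹ f).1 ≠ ∞ := by
        refine ne_of_eq_of_ne (isHomogeneous_totalMass δ _ f hc) ?_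
        exact ENNReal.mul_ne_top ENNReal.coe_ne_top hf
      rw [excess_normalize δ x hfin, div_homogeneous (isHomogeneous_excess δ univ x)
        (isHomogeneous_totalMass δ) _ f hc]
  · filter_upwards [hYΘ] with ω hω
    ext t
    simp only [Function.comp_apply, scale_apply, hω, normalizedField, div_eq_inv_mul]

end CadlagPath

open CadlagPath

theorem mainTheorem3 {d : ℕ} (hd : 1 ≤ d) {Ω Ω₁ Ω₂ : Type*}
    [MeasurableSpace Ω] [MeasurableSpace Ω₁] [MeasurableSpace Ω₂]
    (P : Measure Ω) [IsProbabilityMeasure P]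
    (P₁ : Measure Ω₁) [IsProbabilityMeasure P₁]
    (P₂ : Measure Ω₂) [IsProbabilityMeasure P₂]
    (Z : Ω → FieldPath d) (hZ : IsSpectralField P Z)
    (E : ℕ → Ω₁ → ℝ) (Zc : ℕ → Ω₁ → FieldPath d) (hX : IsDeHaanInput P Z P₁ E Zc)
    (hstat : IsStationaryField P₁ (deHaanField E Zc))
    (Θ : Ω₂ → FieldPath d) (hΘ : IsTiltedField P Z P₂ Θ)
    (δ x : ℝ≥0) :
    ((∀ᵐ ω ∂P, totalMass 0 (Z ω) < ∞) →
      Tendsto (bermanRatio P Z δ x) atTop (𝓝 (berman P Z δ x)) ∧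
      berman P Z δ x = bermanOn P₂ (normalizedField δ Θ) δ univ x ∧
      berman P Z δ x < ∞) ∧
    (0 < P {ω | totalMass 0 (Z ω) < ∞} →
      Tendsto (bermanRatio P Z δ x) atTop (𝓝 (berman P Z δ x)) ∧
      Tendsto (bermanRatio (finiteMassCond P Z) (conditionedField P Z) δ x) atTop
        (𝓝 (berman (finiteMassCond P Z) (conditionedField P Z) δ x)) ∧
      berman P Z δ x = P₂ {ω | totalMass 0 (Θ ω) < ∞} *
        berman (finiteMassCond P Z) (conditionedField P Z) δ x ∧
      berman P Z δ x < ∞) := by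
  obtain ⟨Y, hY, hYZ⟩ := exists_modification hZ.measurable hZ.cadlag
  obtain ⟨Y₂, hY₂, hYΘ⟩ := exists_modification hΘ.measurable hΘ.cadlag
  set μ := P.map Y with hμdef
  have : IsProbabilityMeasure μ := Measure.isProbabilityMeasure_map hY.aemeasurable
  have hμ : IsMaxInvariant μ := isMaxInvariant_map hZ hX hstat hY hYZ
  have hh : 0 < cubeSide δ := cubeSide_pos δ
  have hsup : ∫⁻ f, cubeSup (cubeSide δ) 0 f ∂μ ≠ ∞ := lintegral_cubeSup_ne_top hZ hY hYZ hh
  have hlaw : P₂.map Y₂ = tiltedLaw μ 0 0 := map_eq_tiltedLaw hZ.measurable hΘ hY hYZ hY₂ hYΘ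
  have hhd0 : (cubeSide δ : ℝ≥0∞) ^ d ≠ 0 := pow_ne_zero _ (by exact_mod_cast hh.ne')
  have hhdt : (cubeSide δ : ℝ≥0∞) ^ d ≠ ∞ := ENNReal.pow_ne_top ENNReal.coe_ne_top
  have hlimZ : Tendsto (bermanRatio P Z δ x) atTop
      (𝓝 ((∫⁻ f in univ ∩ firstMax (cubeSide δ) univ 0, excess δ univ x f ∂μ)
        / (cubeSide δ : ℝ≥0∞) ^ d)) := by
    have := tendsto_setLIntegral_excess_Icc hμ δ x hsup (isInvariantSet_univ (cubeSide δ))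
    refine this.congr fun T => ?_
    rw [bermanRatio_eq hY hYZ, Measure.restrict_univ]
  have hbZ := hlimZ.limUnder_eq
  change berman P Z δ x = _ at hbZ
  have hlt : berman P Z δ x < ∞ := by
    rw [hbZ]
    exact ENNReal.div_lt_top
      (ne_top_of_le_ne_top hsup (setLIntegral_excess_firstMax_le δ x univ)) hhd0
  have hG := isInvariantSet_totalMass (d := d) (cubeSide δ)
  set G : Set (CadlagPath d) := {f | totalMass 0 f.1 < ∞} with hGdef
  refine ⟨fun hfin => ⟨hbZ ▸ hlimZ, ?_, hlt⟩, fun hpos => ⟨hbZ ▸ hlimZ, ?_⟩⟩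
  · have hS0 : ∀ᵐ f ∂μ, totalMass 0 f.1 ≠ ∞ := by
      have : ∀ᵐ f ∂μ, f ∈ G := by
        refine (ae_map_iff hY.aemeasurable hG.measurableSet).2 ?_
        filter_upwards [hYZ, hfin] with ω hω h
        rwa [hω]
      filter_upwards [this] with f hf using (show totalMass 0 f.1 < ∞ from hf).ne
    have hsum : ∀ᵐ f ∂μ, ∑' k, cubeSup (cubeSide δ) k f ≠ ∞ := by
      filter_upwards [ae_tsum_cubeSup_ne_top_of_totalMass hμ hh hsup, hS0] with f hf h0 using hf h0
    have hS : ∀ᵐ f ∂μ, totalMass δ f.1 ≠ ∞ := by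
      filter_upwards [hsum] with f hf
      exact ne_top_of_le_ne_top (ENNReal.mul_ne_top hf (by rw [lam_cube]; exact hhdt))
        (totalMass_le hh (fun j => isLamShift_latticePoint δ j) f)
    rw [hbZ, univ_inter, setLIntegral_excess_firstMax_eq hμ δ x hsum,
      bermanOn_normalizedField hY₂ hYΘ hlaw δ x hS, mul_comm, mul_div_assoc, ENNReal.div_self hhd0 hhdt,
      mul_one]
  · set A : Set Ω := {ω | totalMass 0 (Z ω) < ∞} with hA
    have hAA : A =ᵐ[P] Y ⁻¹' G := by
      filter_upwards [hYZ] with ω hω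
      simp only [eq_iff_iff]
      change totalMass 0 (Z ω) < ∞ ↔ totalMass 0 (Y ω).1 < ∞
      rw [hω]
    have hμG : μ G = P A := by
      rw [hμdef, Measure.map_apply hY hG.measurableSet, measure_congr hAA]
    set p := P A with hp
    have hp0 : p ≠ 0 := hpos.ne'
    have hpt : p ≠ ∞ := measure_ne_top P A
    set q := ∫⁻ f in G, (f.1 0 : ℝ≥0∞) ∂μ with hq
    have hq0 : q ≠ 0 := setLIntegral_totalMass_pos hμ (by rw [hμG]; exact hp0)
    have hqt : q ≠ ∞ := ne_top_of_le_ne_top ENNReal.one_ne_top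
      ((setLIntegral_le_lintegral _ _).trans (hμ.mean_one 0).le)
    have hcond : ∀ F : CadlagPath d → ℝ≥0∞, Measurable F →
        ∫⁻ ω, F (Y ω) ∂(finiteMassCond P Z) = p⁻¹ * ∫⁻ f in G, F f ∂μ := by
      intro F hF
      rw [finiteMassCond, ProbabilityTheory.cond, lintegral_smul_measure,
        Measure.restrict_congr_set hAA, hμdef, setLIntegral_map hG.measurableSet hF hY, smul_eq_mul]
    have habs : finiteMassCond P Z ≪ P := by
      exact ProbabilityTheory.cond_absolutelyContinuous
    have hYZ' : ∀ᵐ ω ∂(finiteMassCond P Z), (Y ω).1 = Z ω := habs.ae_le hYZ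
    have hmean : ∫⁻ ω, (Z ω 0 : ℝ≥0∞) ∂(finiteMassCond P Z) = p⁻¹ * q := by
      rw [← hcond _ (measurable_apply 0).coe_nnreal_ennreal]
      refine lintegral_congr_ae ?_
      filter_upwards [hYZ'] with ω hω
      rw [hω]
    have hc0 : p⁻¹ * q ≠ 0 := mul_ne_zero (ENNReal.inv_ne_zero.2 hpt) hq0
    have hct : p⁻¹ * q ≠ ∞ := ENNReal.mul_ne_top (ENNReal.inv_ne_top.2 hp0) hqt
    have hcpos : 0 < (p⁻¹ * q).toNNReal := ENNReal.toNNReal_pos hc0 hct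
    have : SFinite (finiteMassCond P Z) := by
      rw [finiteMassCond, ProbabilityTheory.cond]
      infer_instance
    -- Conditioning contributes `p⁻¹` and the rescaling to mean one contributes `p / q`, so only
    -- `q⁻¹` survives.
    have hratio : ∀ T, bermanRatio (finiteMassCond P Z) (conditionedField P Z) δ x T =
        q⁻¹ * ((∫⁻ f in G, excess δ (Icc 0 fun _ => T) x f ∂μ) / ENNReal.ofReal (T ^ d)) := by
      intro T
      have hYs : Measurable fun ω => scale (p⁻¹ * q).toNNReal⁻¹ (Y ω) :=
        measurable_scale_uncurry.comp (measurable_const.prodMk hY)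
      have hex := measurable_excess (d := d) δ (K := Icc 0 fun _ => T) measurableSet_Icc x
      rw [bermanRatio, bermanOn_eq_lintegral_excess hYs _ δ x measurableSet_Icc]
      · simp only [isHomogeneous_excess δ _ x _ _ (inv_pos.2 hcpos)]
        rw [lintegral_const_mul' _ _ ENNReal.coe_ne_top, hcond _ hex, ENNReal.coe_inv hcpos.ne',
          ENNReal.coe_toNNReal hct, ← mul_assoc, mul_div_assoc]
        congr 1
        rw [ENNReal.mul_inv (Or.inl (ENNReal.inv_ne_zero.2 hpt)) (Or.inl (ENNReal.inv_ne_top.2 hp0)),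
          inv_inv, mul_comm p, mul_assoc, ENNReal.mul_inv_cancel hp0 hpt, mul_one]
      · filter_upwards [hYZ'] with ω hω
        ext t
        simp only [scale_apply, hω, conditionedField, hmean, div_eq_inv_mul]
    have hlimV := ENNReal.Tendsto.const_mul (a := q⁻¹)
      (tendsto_setLIntegral_excess_Icc hμ δ x hsup hG) (Or.inr (ENNReal.inv_ne_top.2 hq0))
    rw [setLIntegral_excess_firstMax_totalMass hμ δ x hsup, ← hbZ] at hlimV
    have hlimV' : Tendsto (bermanRatio (finiteMassCond P Z) (conditionedField P Z) δ x) atTop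
        (𝓝 (q⁻¹ * berman P Z δ x)) := hlimV.congr fun T => (hratio T).symm
    have hbV := hlimV'.limUnder_eq
    change berman _ _ δ x = _ at hbV
    -- Finiteness of the mass is scale invariant, so normalising by `Z(0)` does not affect it, and
    -- paths vanishing at `0` have no weight under the tilt.
    have hPΘ : P₂ {ω | totalMass 0 (Θ ω) < ∞} = q := by
      have h1 : P₂ {ω | totalMass 0 (Θ ω) < ∞} = P₂ (Y₂ ⁻¹' G) := by
        refine measure_congr ?_
        filter_upwards [hYΘ] with ω hω
        simp only [eq_iff_iff]
        change totalMass 0 (Θ ω) < ∞ ↔ totalMass 0 (Y₂ ω).1 < ∞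
        rw [hω]
      rw [h1, ← Measure.map_apply hY₂ hG.measurableSet, hlaw, ← lintegral_indicator_one hG.measurableSet,
        lintegral_tiltedLaw _ _ _ (measurable_one.indicator hG.measurableSet), hq,
        ← lintegral_indicator hG.measurableSet]
      refine lintegral_congr fun f => ?_
      rw [add_zero, shift_zero]
      rcases eq_or_ne (f.1 0) 0 with h0 | h0
      · simp [h0, indicator]
      · have hiff := hG.scale_mem (f.1 0)⁻¹ f (inv_pos.2 (pos_iff_ne_zero.2 h0))
        by_cases hf : f ∈ G
        · rw [indicator_of_mem hf, indicator_of_mem (hiff.2 hf), Pi.one_apply, mul_one]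
        · rw [indicator_of_notMem hf, indicator_of_notMem (mt hiff.1 hf), mul_zero]
    refine ⟨hbV ▸ hlimV', ?_, hlt⟩
    rw [hPΘ, hbV, ← mul_assoc, ENNReal.mul_inv_cancel hq0 hqt, one_mul]
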